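/- Given finite graphs $G, H_1, H_2$, write $G\to(H_1,H_2)$ if every colouring of $E(G)$ (with any number of colours) contains a monochromatic copy of $H_1$ (all its edges have the same colour) or a rainbow copy of $H_2$ (no two of its edges have the same colour); copies are not necessarily induced. A function $\hat p\colon\mathbb N\to[0,1]$ is a threshold for this property if, for the binomial random graph $G(n,p)$ with $p=p(n)\in[0,1]$, $\lim_{n\to\infty}\mathbb P[G(n,p)\to(H_1,H_2)]=1$ whenever $\hat p=o(p)$, and $\lim_{n\to\infty}\mathbb P[G(n,p)\to(H_1,H_2)]=0$ whenever $p=o(\hat p)$; it is unique up to constant factors and we then write $\hat p(H_1,H_2)=\hat p$. Let $e(J)$ and $v(J)$ be the numbers of edges and of vertices of $J$, and let $m(H)=\max\{e(J)/v(J): J\subseteq H,\ v(J)\ge 1\}$. A cherry is the path $K_{1,2}$ with two edges; a matching is a disjoint union of edges; a short forest is a disjoint union of edges and cherries. In these three notions additional isolated vertices are allowed. Let $H_1$ be a finite graph and let $H_2$ be a finite forest with $\min\{e(H_1),e(H_2)\}\ge 2$. (i) If $H_1$ is a matching and $H_2$ is not a short forest, then $\hat p(H_1,H_2)=n^{-1}$.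 (ii) If $H_1$ is not a forest and $H_2$ is a cherry, or else $H_1$ is arbitrary and $H_2$ is a matching with exactly two edges, then $\hat p(H_1,H_2)=n^{-1/m(H_1)}$. (iii) If $H_1$ is a forest with $k$ non-isolated vertices and $H_2$ is a cherry, then $\hat p(H_1,H_2)=n^{-k/(k-1)}$. -/

import Mathlib

open Filter Topology MeasureTheory

namespace ConstrainedRamsey

/-- `f` is a monochromatic copy of `H` in `G` under the edge colouring `χ`. -/
def IsMonochromatic {V W : Type*} {H : SimpleGraph W} {G : SimpleGraph V}
    (χ : G.EdgeLabeling ℕ) (f : SimpleGraph.Copy H G) : Prop :=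
  ∃ c : ℕ, ∀ e : H.edgeSet, χ (f.mapEdgeSet e) = c

/-- `f` is a rainbow copy of `H` in `G` under the edge colouring `χ`. -/
def IsRainbow {V W : Type*} {H : SimpleGraph W} {G : SimpleGraph V}
    (χ : G.EdgeLabeling ℕ) (f : SimpleGraph.Copy H G) : Prop :=
  ∀ e e' : H.edgeSet, χ (f.mapEdgeSet e) = χ (f.mapEdgeSet e') → e = e'

/-- Every edge colouring of `G` has a monochromatic copy of `H₁` or a rainbow copy of `H₂`.
For the finite (or countable) graphs `G` of interest, colours in `ℕ` are no restriction on the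
number of colours. -/
def Arrows {V W₁ W₂ : Type*} (G : SimpleGraph V) (H₁ : SimpleGraph W₁) (H₂ : SimpleGraph W₂) :
    Prop :=
  ∀ χ : G.EdgeLabeling ℕ,
    (∃ f : SimpleGraph.Copy H₁ G, IsMonochromatic χ f) ∨
    (∃ f : SimpleGraph.Copy H₂ G, IsRainbow χ f)

/-- `q : ℕ → [0,1]` is a threshold function for the graph property `P`: for `p ≫ q` the random
graph `G(n, p)` satisfies `P` with probability tending to `1`, and for `p ≪ q` with probability
tending to `0`. -/
def IsThreshold (P : ∀ n : ℕ, SimpleGraph (Fin n) → Prop) (q : ℕ → ℝ) : Prop :=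
  (∀ n, q n ∈ Set.Icc (0 : ℝ) 1) ∧
  ∀ p : ℕ → unitInterval,
    ((q =o[atTop] fun n => (p n : ℝ)) →
      Tendsto (fun n => (SimpleGraph.binomialRandom (Fin n) (p n)).real {G | P n G})
        atTop (𝓝 1)) ∧
    (((fun n => (p n : ℝ)) =o[atTop] q) →
      Tendsto (fun n => (SimpleGraph.binomialRandom (Fin n) (p n)).real {G | P n G})
        atTop (𝓝 0))

/-- `q` is (up to constant factors) the threshold for `G(n, p)` to have the constrained Ramsey
property for `(H₁, H₂)`. -/
def IsRamseyThreshold {W₁ W₂ : Type*} (H₁ : SimpleGraph W₁) (H₂ : SimpleGraph W₂)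
    (q : ℕ → ℝ) : Prop :=
  IsThreshold (fun _ G => Arrows G H₁ H₂) q

/-- The maximum density `max {e(J) / v(J) : J ⊆ H, v(J) ≥ 1}` of a finite graph with at least one
vertex (a maximum over a nonempty finite set). -/
noncomputable def maxDensity {W : Type*} (H : SimpleGraph W) : ℝ :=
  sSup {x : ℝ | ∃ J : H.Subgraph, J.verts.Nonempty ∧
    x = (J.edgeSet.ncard : ℝ) / (J.verts.ncard : ℝ)}

/-- The cherry `K_{1,2}`. -/
abbrev cherry : SimpleGraph (Fin 1 ⊕ Fin 2) := completeBipartiteGraph (Fin 1) (Fin 2)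

/-- No two distinct edges share a vertex (isolated vertices allowed). -/
def IsMatching {W : Type*} (H : SimpleGraph W) : Prop :=
  ∀ u v w, H.Adj u v → H.Adj u w → v = w

/-- A disjoint union of edges and cherries, and possibly isolated vertices. -/
def IsShortForest {W : Type*} (H : SimpleGraph W) : Prop :=
  ∀ C : H.ConnectedComponent,
    C.supp.Subsingleton ∨
    Nonempty (H.induce C.supp ≃g (⊤ : SimpleGraph (Fin 2))) ∨
    Nonempty (H.induce C.supp ≃g cherry)

/-- `H` is a cherry, up to isolated vertices; `H.support` is the set of non-isolated vertices. -/
def IsCherry {W : Type*} (H : SimpleGraph W) : Prop :=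
  Nonempty (H.induce H.support ≃g cherry)

/-- `H` is a matching with exactly two edges, up to isolated vertices. -/
def IsTwoEdgeMatching {W : Type*} (H : SimpleGraph W) : Prop :=
  IsMatching H ∧ H.edgeSet.ncard = 2

end ConstrainedRamsey

/-!
# Thresholds for the constrained Ramsey property of forests

*Containment.* All lower bounds on `p` come from the second moment method. If `n ^ |J| * p ^ e(H[J])`
tends to infinity for every nonempty set `J` of vertices of `H`, then `G(n, p)` contains a copy of
`H` with high probability; moreover the copy can be chosen to avoid, for each copy, a bad event of
probability `o(1)` which does not depend on the edges of this copy
(`tendsto_measureReal_exists_copy`). The upper bounds are first moment bounds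
(`measureReal_isContained_le`).

*A matching against a forest that is not short.* For `p ≪ 1 / n` the random graph is a forest.
Colour each edge by one of its endpoints: this never creates two disjoint edges of the same colour.
If the endpoint is chosen in a fixed class of the bipartition, then no path with three edges is
rainbow, and if it is the one closer to the root, then each vertex sees at most two colours; a
forest which is not short contains a path with three edges or a vertex of degree three
(`not_arrows_of_isAcyclic`). For `p ≫ 1 / n` the chromatic number tends to infinity, and this
suffices: if no colour class contains the matching, then every colour class has a cover of bounded
size, and in the spirit of Burr's theorem on oriented trees in digraphs of large chromatic number
one finds any tree in rainbow colours (`exists_rainbow_tree`). Namely, the vertices that see few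
colours span a graph with an orientation of bounded outdegree, hence of bounded chromatic number;
the remaining vertices host, by induction, the tree without a leaf, to which the leaf can be added.

*Cherries.* If no cherry is rainbow, then all edges of a component have the same colour, so
`G → (H₁, cherry)` says that some component contains the edges of `H₁`. If `H₁` has a cycle, then
`m(H₁) ≥ 1`, so `p ≫ n ^ (-1 / m(H₁))` implies `p ≫ 1 / n`, and almost all vertices lie in one
component. A vertex of a given copy of `H₁` fails to be attached to the giant component of the rest
with probability `o(1)`: by symmetry all vertices have the same probability, and on average few
fail (`measureReal_not_isLargeIn_le`). So some copy lies in the giant component. If `H₁` is a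
forest with `k` non-isolated vertices, the question is when a component with `k` vertices appears,
that is, a tree on `k` vertices.

*A matching with two edges.* If no such matching is rainbow, then all disjoint edges have the same
colour, so two disjoint copies of `H₁` are monochromatic; two copies are as dense as one.
-/

namespace ConstrainedRamsey

open SimpleGraph unitInterval

/-! ### The binomial random graph -/

instance {V : Type*} [Countable V] : MeasurableSingletonClass (SimpleGraph V) where
  measurableSet_singleton G := by
    rw [← measurableEmbedding_edgeSet.measurableSet_image, Set.image_singleton]
    exact measurableSet_singleton _

/-- The event `A` is not affected by the presence or absence of the edges in `F`. -/
def IgnoresEdges {V : Type*} (A : Set (SimpleGraph V)) (F : Set (Sym2 V)) : Prop :=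
  ∀ G G' : SimpleGraph V, (∀ e ∉ F, e ∈ G.edgeSet ↔ e ∈ G'.edgeSet) → (G ∈ A ↔ G' ∈ A)

section Probability

variable {V : Type*} [Finite V] (p : I)

lemma binomialRandom_real_singleton (G : SimpleGraph V) :
    (binomialRandom V p).real {G} =
      (p : ℝ) ^ G.edgeSet.ncard * (1 - p : ℝ) ^ ((Nat.card V).choose 2 - G.edgeSet.ncard) := by
  simp [measureReal_def, binomialRandom_singleton]

lemma ncard_edgeSet_le_choose (G : SimpleGraph V) :
    G.edgeSet.ncard ≤ (Nat.card V).choose 2 := by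
  classical
  cases nonempty_fintype V
  rw [← coe_edgeFinset, Set.ncard_coe_finset, Nat.card_eq_fintype_card]
  exact G.card_edgeFinset_le_card_choose_two

lemma measureReal_eq_sum [Fintype (SimpleGraph V)] (A : Set (SimpleGraph V))
    [DecidablePred (· ∈ A)] :
    (binomialRandom V p).real A =
      ∑ G : SimpleGraph V with G ∈ A, (binomialRandom V p).real {G} := by
  rw [sum_measureReal_singleton]
  simp

/-- Toggling `e` changes the weight of a graph by the factor `p / (1 - p)`. -/
lemma mul_measureReal_inter_mem (e : Sym2 V) (he : ¬ e.IsDiag) (A : Set (SimpleGraph V))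
    (hA : IgnoresEdges A {e}) :
    (1 - p : ℝ) * (binomialRandom V p).real (A ∩ {G | e ∈ G.edgeSet}) =
      p * (binomialRandom V p).real (A ∩ {G | e ∉ G.edgeSet}) := by
  classical
  cases nonempty_fintype V
  rw [measureReal_eq_sum, measureReal_eq_sum, Finset.mul_sum, Finset.mul_sum]
  have hdel (G : SimpleGraph V) : ∀ e' ∉ ({e} : Set (Sym2 V)),
      e' ∈ G.edgeSet ↔ e' ∈ (G.deleteEdges {e}).edgeSet := by
    intro e' he'
    simp_all
  have hadd (G : SimpleGraph V) : ∀ e' ∉ ({e} : Set (Sym2 V)),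
      e' ∈ G.edgeSet ↔ e' ∈ (G ⊔ fromEdgeSet {e}).edgeSet := by
    intro e' he'
    simp_all
  refine Finset.sum_nbij' (fun G => G.deleteEdges {e}) (fun G => G ⊔ fromEdgeSet {e}) ?_ ?_ ?_ ?_ ?_
  · intro G hG
    simp only [Finset.mem_filter, Finset.mem_univ, true_and, Set.mem_inter_iff] at hG ⊢
    exact ⟨(hA _ _ (hdel G)).1 hG.1, by simp⟩
  · intro G hG
    simp only [Finset.mem_filter, Finset.mem_univ, true_and, Set.mem_inter_iff] at hG ⊢
    refine ⟨(hA _ _ (hadd G)).1 hG.1, ?_⟩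
    simp [he]
  · intro G hG
    simp only [Finset.mem_filter, Finset.mem_univ, true_and, Set.mem_inter_iff,
      Set.mem_ofPred_eq] at hG
    rw [← edgeSet_inj]
    ext e'
    by_cases h : e' = e
    · subst h; simp [he, hG.2]
    · simp [h]
  · intro G hG
    simp only [Finset.mem_filter, Finset.mem_univ, true_and, Set.mem_inter_iff,
      Set.mem_ofPred_eq] at hG
    rw [← edgeSet_inj]
    ext e'
    by_cases h : e' = e
    · subst h; simpa [he] using hG.2
    · simp [h]
  · intro G hG
    simp only [Finset.mem_filter, Finset.mem_univ, true_and, Set.mem_inter_iff,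
      Set.mem_ofPred_eq] at hG
    have hcard : (G.deleteEdges {e}).edgeSet.ncard + 1 = G.edgeSet.ncard := by
      rw [edgeSet_deleteEdges]
      exact Set.ncard_sdiff_singleton_add_one hG.2
    have hle := ncard_edgeSet_le_choose G
    rw [binomialRandom_real_singleton, binomialRandom_real_singleton, ← hcard]
    rw [show (Nat.card V).choose 2 - (G.deleteEdges {e}).edgeSet.ncard =
      (Nat.card V).choose 2 - ((G.deleteEdges {e}).edgeSet.ncard + 1) + 1 by omega]
    ring

lemma measureReal_inter_mem (e : Sym2 V) (he : ¬ e.IsDiag) (A : Set (SimpleGraph V))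
    (hA : IgnoresEdges A {e}) :
    (binomialRandom V p).real (A ∩ {G | e ∈ G.edgeSet}) = p * (binomialRandom V p).real A := by
  have h := mul_measureReal_inter_mem p e he A hA
  have h2 := measureReal_inter_add_sdiff (μ := binomialRandom V p) (s := A) (t := {G | e ∈ G.edgeSet})
    (Set.toFinite _).measurableSet
  have h3 : A \ {G | e ∈ G.edgeSet} = A ∩ {G | e ∉ G.edgeSet} := rfl
  rw [h3] at h2
  rw [← h2]
  linarith

lemma measureReal_inter_notMem (e : Sym2 V) (he : ¬ e.IsDiag) (A : Set (SimpleGraph V))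
    (hA : IgnoresEdges A {e}) :
    (binomialRandom V p).real (A ∩ {G | e ∉ G.edgeSet}) =
      (1 - p) * (binomialRandom V p).real A := by
  have h := measureReal_inter_mem p e he A hA
  have h2 := measureReal_inter_add_sdiff (μ := binomialRandom V p) (s := A) (t := {G | e ∈ G.edgeSet})
    (Set.toFinite _).measurableSet
  have h3 : A \ {G | e ∈ G.edgeSet} = A ∩ {G | e ∉ G.edgeSet} := rfl
  rw [h3] at h2
  linarith

/-- The edges in `F` are present independently of an event that ignores them. -/
lemma measureReal_inter_subset (F : Finset (Sym2 V)) (hF : ∀ e ∈ F, ¬ e.IsDiag)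
    (A : Set (SimpleGraph V)) (hA : IgnoresEdges A F) :
    (binomialRandom V p).real (A ∩ {G | (F : Set (Sym2 V)) ⊆ G.edgeSet}) =
      p ^ F.card * (binomialRandom V p).real A := by
  classical
  induction F using Finset.induction_on with
  | empty => simp
  | insert e F he ih =>
    have hA' : IgnoresEdges A (F : Set (Sym2 V)) := fun G G' h =>
      hA G G' fun e' he' => h e' (by simp_all)
    have key : IgnoresEdges (A ∩ {G | (F : Set (Sym2 V)) ⊆ G.edgeSet}) {e} := by
      intro G G' h
      refine and_congr (hA G G' fun e' he' => h e' (by simp_all)) ?_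
      refine forall₂_congr fun e' he' => h e' ?_
      rintro rfl
      exact he he'
    rw [Finset.card_insert_of_notMem he, pow_succ, mul_right_comm,
      ← ih (fun e' he' => hF e' (Finset.mem_insert_of_mem he')) hA', mul_comm,
      ← measureReal_inter_mem p e (hF e (Finset.mem_insert_self _ _)) _ key]
    congr 1
    ext G
    simp [Set.insert_subset_iff]
    tauto

lemma measureReal_inter_disjoint (F : Finset (Sym2 V)) (hF : ∀ e ∈ F, ¬ e.IsDiag)
    (A : Set (SimpleGraph V)) (hA : IgnoresEdges A F) :
    (binomialRandom V p).real (A ∩ {G | ∀ e ∈ F, e ∉ G.edgeSet}) =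
      (1 - p) ^ F.card * (binomialRandom V p).real A := by
  classical
  induction F using Finset.induction_on with
  | empty => simp
  | insert e F he ih =>
    have hA' : IgnoresEdges A (F : Set (Sym2 V)) := fun G G' h =>
      hA G G' fun e' he' => h e' (by simp_all)
    have key : IgnoresEdges (A ∩ {G | ∀ e ∈ F, e ∉ G.edgeSet}) {e} := by
      intro G G' h
      refine and_congr (hA G G' fun e' he' => h e' (by simp_all)) ?_
      refine forall₂_congr fun e' he' => not_congr (h e' ?_)
      rintro rfl
      exact he he'
    rw [Finset.card_insert_of_notMem he, pow_succ, mul_right_comm,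
      ← ih (fun e' he' => hF e' (Finset.mem_insert_of_mem he')) hA', mul_comm,
      ← measureReal_inter_notMem p e (hF e (Finset.mem_insert_self _ _)) _ key]
    congr 1
    ext G
    simp
    tauto

lemma ignoresEdges_univ {V : Type*} (F : Set (Sym2 V)) : IgnoresEdges Set.univ F :=
  fun _ _ _ => Iff.rfl

lemma measureReal_subset (F : Finset (Sym2 V)) (hF : ∀ e ∈ F, ¬ e.IsDiag) :
    (binomialRandom V p).real {G | (F : Set (Sym2 V)) ⊆ G.edgeSet} = p ^ F.card := by
  simpa using measureReal_inter_subset p F hF Set.univ (ignoresEdges_univ _)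

lemma measureReal_disjoint (F : Finset (Sym2 V)) (hF : ∀ e ∈ F, ¬ e.IsDiag) :
    (binomialRandom V p).real {G | ∀ e ∈ F, e ∉ G.edgeSet} = (1 - p) ^ F.card := by
  simpa using measureReal_inter_disjoint p F hF Set.univ (ignoresEdges_univ _)

/-- The law of `G(V, p)` is invariant under permutations of the vertices. -/
lemma measureReal_preimage_map (τ : V ≃ V) (A : Set (SimpleGraph V)) :
    (binomialRandom V p).real {G | G.map τ.toEmbedding ∈ A} = (binomialRandom V p).real A := by
  classical
  cases nonempty_fintype V
  rw [measureReal_eq_sum, measureReal_eq_sum]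
  refine Finset.sum_nbij' (fun G => G.map τ.toEmbedding) (fun G => G.map τ.symm.toEmbedding)
    ?_ ?_ ?_ ?_ ?_
  · intro G hG; simpa using hG
  · intro G hG
    simpa [SimpleGraph.map_map] using hG
  · intro G hG; simp [SimpleGraph.map_map]
  · intro G hG; simp [SimpleGraph.map_map]
  · intro G hG
    rw [binomialRandom_real_singleton, binomialRandom_real_singleton]
    have : (G.map τ.toEmbedding).edgeSet.ncard = G.edgeSet.ncard := by
      rw [edgeSet_map]
      exact Set.ncard_image_of_injective _ (Function.Embedding.injective _)
    rw [this]

end Probability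

section Copies

variable {W V : Type*}

/-- The image of the edge set of `H` under a map of the vertices. -/
noncomputable def edgeImage [Finite W] (H : SimpleGraph W) (f : W → V) : Finset (Sym2 V) :=
  (Set.toFinite (Sym2.map f '' H.edgeSet)).toFinset

lemma mem_edgeImage [Finite W] {H : SimpleGraph W} {f : W → V} {e : Sym2 V} :
    e ∈ edgeImage H f ↔ ∃ e' ∈ H.edgeSet, e'.map f = e := by
  simp [edgeImage]

lemma edgeImage_subset_iff [Finite W] {H : SimpleGraph W} {f : W → V} {G : SimpleGraph V} :
    (edgeImage H f : Set (Sym2 V)) ⊆ G.edgeSet ↔ ∀ a b, H.Adj a b → G.Adj (f a) (f b) := by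
  constructor
  · intro h a b hab
    exact h (mem_edgeImage.2 ⟨s(a, b), hab, rfl⟩)
  · rintro h e he
    obtain ⟨e', he', rfl⟩ := mem_edgeImage.1 he
    induction e' with
    | _ a b => exact h a b he'

lemma card_edgeImage [Finite W] (H : SimpleGraph W) (f : W ↪ V) :
    (edgeImage H f).card = H.edgeSet.ncard := by
  rw [edgeImage, ← Set.ncard_eq_toFinset_card _ (Set.toFinite _)]
  exact Set.ncard_image_of_injective _ (Sym2.map.injective f.injective)

lemma not_isDiag_of_mem_edgeImage [Finite W] {H : SimpleGraph W} {f : W ↪ V} {e : Sym2 V}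
    (he : e ∈ edgeImage H f) : ¬ e.IsDiag := by
  obtain ⟨e', he', rfl⟩ := mem_edgeImage.1 he
  induction e' with
  | _ a b => simpa using H.ne_of_adj he'

/-- The copy of `H` given by an injection that maps edges to edges. -/
def copyOfInjective {H : SimpleGraph W} {G : SimpleGraph V} (f : W → V)
    (hf : Function.Injective f) (h : ∀ a b, H.Adj a b → G.Adj (f a) (f b)) : Copy H G :=
  ⟨⟨f, fun {a b} => h a b⟩, hf⟩

@[simp] lemma copyOfInjective_apply {H : SimpleGraph W} {G : SimpleGraph V} (f : W → V)
    (hf : Function.Injective f) (h : ∀ a b, H.Adj a b → G.Adj (f a) (f b)) (a : W) :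
    copyOfInjective f hf h a = f a := rfl

/-- First moment bound for the appearance of a copy of `H`. -/
lemma measureReal_isContained_le [Finite W] [Finite V] (p : I) (H : SimpleGraph W) :
    (binomialRandom V p).real {G | H ⊑ G} ≤
      (Nat.card V : ℝ) ^ Nat.card W * (p : ℝ) ^ H.edgeSet.ncard := by
  classical
  cases nonempty_fintype V
  cases nonempty_fintype W
  have hsub : {G : SimpleGraph V | H ⊑ G} ⊆
      ⋃ f : W ↪ V, {G | (edgeImage H f : Set (Sym2 V)) ⊆ G.edgeSet} := by
    rintro G ⟨f⟩
    refine Set.mem_iUnion.2 ⟨f.toEmbedding, ?_⟩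
    exact edgeImage_subset_iff.2 fun a b hab => f.toHom.map_adj hab
  calc (binomialRandom V p).real {G | H ⊑ G}
      ≤ ∑ f : W ↪ V, (binomialRandom V p).real
          {G | (edgeImage H f : Set (Sym2 V)) ⊆ G.edgeSet} :=
        (measureReal_mono hsub).trans (measureReal_iUnion_fintype_le _)
    _ = ∑ f : W ↪ V, (p : ℝ) ^ H.edgeSet.ncard := by
        refine Finset.sum_congr rfl fun f _ => ?_
        rw [measureReal_subset p _ fun e he => not_isDiag_of_mem_edgeImage he, card_edgeImage]
    _ = Fintype.card (W ↪ V) * (p : ℝ) ^ H.edgeSet.ncard := by simp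
    _ ≤ _ := by
        gcongr
        · exact pow_nonneg p.2.1 _
        · rw [Fintype.card_embedding_eq, Nat.card_eq_fintype_card, Nat.card_eq_fintype_card]
          exact_mod_cast Nat.descFactorial_le_pow _ _

end Copies

/-! ### Second moment method -/

section SecondMoment

/-- Chebyshev's inequality for the number `X` of events `A i` that occur, with mean `M`, combined
with Markov's inequality for the number of events `A i ∩ B i` that occur. -/
lemma measureReal_forall_imp_le {Ω ι : Type*} [Finite Ω] [MeasurableSpace Ω]
    [MeasurableSingletonClass Ω] [Fintype ι] (μ : Measure Ω) [IsProbabilityMeasure μ]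
    (A B : ι → Set Ω) (M : ℝ) (hM : 0 < M) (hMA : ∑ i, μ.real (A i) = M) :
    μ.real {ω | ∀ i, ω ∈ A i → ω ∈ B i} ≤
      4 * ((∑ i, ∑ j, μ.real (A i ∩ A j)) - M ^ 2) / M ^ 2 +
        2 * (∑ i, μ.real (A i ∩ B i)) / M := by
  classical
  have hmeas (S : Set Ω) : MeasurableSet S := (Set.toFinite S).measurableSet
  have hint (f : Ω → ℝ) : Integrable f μ := Integrable.of_finite
  set X : Ω → ℝ := fun ω => ∑ i, (A i).indicator 1 ω with hX
  set Y : Ω → ℝ := fun ω => ∑ i, (A i ∩ B i).indicator 1 ω with hY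
  have hind (S : Set Ω) : ∫ ω, S.indicator (1 : Ω → ℝ) ω ∂μ = μ.real S :=
    integral_indicator_one (hmeas S)
  have hEX : ∫ ω, X ω ∂μ = M := by
    rw [hX, integral_finsetSum _ fun i _ => hint _]
    simp only [hind, hMA]
  have hEY : ∫ ω, Y ω ∂μ = ∑ i, μ.real (A i ∩ B i) := by
    rw [hY, integral_finsetSum _ fun i _ => hint _]
    simp only [hind]
  have hEXX : ∫ ω, X ω ^ 2 ∂μ = ∑ i, ∑ j, μ.real (A i ∩ A j) := by
    have : (fun ω => X ω ^ 2) = fun ω => ∑ i, ∑ j, (A i ∩ A j).indicator (1 : Ω → ℝ) ω := by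
      funext ω
      simp only [hX, sq, Finset.sum_mul_sum, Set.inter_indicator_one, Pi.mul_apply]
    rw [this, integral_finsetSum _ fun i _ => hint _]
    refine Finset.sum_congr rfl fun i _ => ?_
    rw [integral_finsetSum _ fun i _ => hint _]
    simp only [hind]
  have hpt (ω : Ω) : ({ω | ∀ i, ω ∈ A i → ω ∈ B i} : Set Ω).indicator (1 : Ω → ℝ) ω ≤
      4 / M ^ 2 * (X ω - M) ^ 2 + 2 / M * Y ω := by
    have hY0 : 0 ≤ Y ω := Finset.sum_nonneg fun i _ => Set.indicator_nonneg (by simp) _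
    by_cases h : ∀ i, ω ∈ A i → ω ∈ B i
    · have hXY : X ω = Y ω := by
        refine Finset.sum_congr rfl fun i _ => ?_
        by_cases hi : ω ∈ A i
        · simp [hi, h i hi]
        · simp [hi]
      rw [Set.indicator_of_mem (by exact h), Pi.one_apply, ← hXY]
      have h1 : 4 / M ^ 2 * (X ω - M) ^ 2 + 2 / M * X ω - 1 = (2 * (X ω - M) / M + 1/2) ^ 2 + 3/4 := by
        field_simp
        ring
      nlinarith [sq_nonneg (2 * (X ω - M) / M + 1/2)]
    · rw [Set.indicator_of_notMem (by exact h)]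
      positivity
  have := integral_mono (μ := μ) (hint _) (hint _) hpt
  rw [hind, integral_add (hint _) (hint _), integral_const_mul, integral_const_mul, hEY] at this
  have hvar : ∫ ω, (X ω - M) ^ 2 ∂μ = (∑ i, ∑ j, μ.real (A i ∩ A j)) - M ^ 2 := by
    have : (fun ω => (X ω - M) ^ 2) = fun ω => (X ω ^ 2 - 2 * M * X ω) + M ^ 2 := by
      funext ω; ring
    rw [this, integral_add (hint _) (hint _), integral_sub (hint _) (hint _), integral_const_mul,
      hEX, hEXX]
    simp
    ring
  rw [hvar] at this
  refine this.trans_eq ?_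
  ring

variable {W V : Type*}

/-- The edges of `H` inside the vertex set `J`. -/
def edgesIn {W : Type*} (H : SimpleGraph W) (J : Set W) : Set (Sym2 W) :=
  {e ∈ H.edgeSet | ∀ x ∈ e, x ∈ J}

lemma edgesIn_empty {W : Type*} (H : SimpleGraph W) : edgesIn H ∅ = ∅ := by
  ext e
  induction e with
  | _ a b => simpa [edgesIn] using fun _ => ⟨a, fun h => absurd rfl h⟩

/-- Two copies of `H` share at most as many edges as `H` has on the set of vertices of the second
copy which lie in the first one. -/
lemma two_mul_ncard_le_card_union [Finite W] [DecidableEq V] (H : SimpleGraph W) (f g : W ↪ V) :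
    2 * H.edgeSet.ncard ≤ (edgeImage H f ∪ edgeImage H g).card +
      (edgesIn H (g ⁻¹' Set.range f)).ncard := by
  have h := Finset.card_union_add_card_inter (edgeImage H f) (edgeImage H g)
  rw [card_edgeImage, card_edgeImage] at h
  have h2 : (edgeImage H f ∩ edgeImage H g).card ≤ (edgesIn H (g ⁻¹' Set.range f)).ncard := by
    rw [← Set.ncard_coe_finset, ← Set.ncard_image_of_injective _ (Sym2.map.injective g.injective)]
    refine Set.ncard_le_ncard ?_ (Set.toFinite _)
    intro e he
    simp only [Finset.coe_inter, Set.mem_inter_iff, Finset.mem_coe, mem_edgeImage] at he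
    obtain ⟨⟨e₁, he₁, rfl⟩, e₂, he₂, h⟩ := he
    refine ⟨e₂, ⟨he₂, fun x hx => ?_⟩, h⟩
    have : g x ∈ Sym2.map f e₁ := h ▸ Sym2.mem_map.2 ⟨x, hx, rfl⟩
    obtain ⟨y, -, hy⟩ := Sym2.mem_map.1 this
    exact ⟨y, hy⟩
  omega

lemma card_filter_preimage_range_le [Fintype W] [Fintype V] [DecidableEq W] [DecidableEq V]
    (f : W ↪ V) (J : Finset W) :
    (Finset.univ.filter fun g : W ↪ V => (g ⁻¹' Set.range f) = (J : Set W)).card ≤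
      Fintype.card W ^ J.card * Fintype.card V ^ (Fintype.card W - J.card) := by
  let t : W → Finset V := fun w => if w ∈ J then Finset.univ.map f else Finset.univ
  have hcard : (Fintype.piFinset t).card =
      Fintype.card W ^ J.card * Fintype.card V ^ (Fintype.card W - J.card) := by
    have (w : W) : (t w).card = if w ∈ J then Fintype.card W else Fintype.card V := by
      by_cases h : w ∈ J <;> simp [t, h]
    rw [Fintype.card_piFinset, Finset.prod_congr rfl fun w _ => this w, Finset.prod_ite]
    simp only [Finset.prod_const]
    congr 2
    · simp
    · rw [← Finset.card_compl]
      congr 1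
      ext; simp
  rw [← hcard]
  refine Finset.card_le_card_of_injOn (fun g => (g : W → V)) ?_
    (fun g _ g' _ h => DFunLike.coe_injective h)
  intro g hg
  simp only [Finset.coe_filter, Finset.mem_univ, true_and, Set.mem_ofPred_eq] at hg
  simp only [Finset.mem_coe, Fintype.mem_piFinset]
  intro w
  by_cases h : w ∈ J
  · have : w ∈ g ⁻¹' Set.range f := by rw [hg]; exact h
    obtain ⟨y, hy⟩ := this
    simp [t, h]
    exact ⟨y, hy⟩
  · simp [t, h]

/-- Second moment bound: the probability that every copy of `H` on which the random graph contains
`H` is bad, where the badness of a copy does not depend on the edges of this copy and has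
probability at most `δ`. -/
lemma measureReal_forall_copy_le [Finite W] [Finite V] (p : I) (hp : 0 < (p : ℝ)) (H : SimpleGraph W)
    (hWV : 2 * Nat.card W ≤ Nat.card V) (hV : 0 < Nat.card V) (D : (W ↪ V) → Set (SimpleGraph V))
    (hD : ∀ f, IgnoresEdges (D f) (edgeImage H f)) (δ : ℝ)
    (hδ : ∀ f, (binomialRandom V p).real (D f) ≤ δ) :
    (binomialRandom V p).real
      {G | ∀ f : W ↪ V, (∀ a b, H.Adj a b → G.Adj (f a) (f b)) → G ∈ D f} ≤
    4 * ((2 * Nat.card W : ℝ) ^ Nat.card W * ∑ᶠ J ∈ {J : Set W | J.Nonempty},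
      ((Nat.card V : ℝ) ^ J.ncard * (p : ℝ) ^ (edgesIn H J).ncard)⁻¹) + 2 * δ := by
  classical
  cases nonempty_fintype V
  cases nonempty_fintype W
  set n := Nat.card V with hn
  set v := Nat.card W with hv
  set e := H.edgeSet.ncard with he
  set μ := binomialRandom V p with hμ
  set A : (W ↪ V) → Set (SimpleGraph V) := fun f => {G | (edgeImage H f : Set (Sym2 V)) ⊆ G.edgeSet}
    with hA
  have hp1 : (p : ℝ) ≤ 1 := p.2.2
  have hset : {G : SimpleGraph V | ∀ f : W ↪ V, (∀ a b, H.Adj a b → G.Adj (f a) (f b)) → G ∈ D f} =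
      {G | ∀ f, G ∈ A f → G ∈ D f} := by
    ext G
    simp only [hA, Set.mem_ofPred_eq, edgeImage_subset_iff]
  have hAp (f) : μ.real (A f) = (p : ℝ) ^ e := by
    rw [hμ, hA, measureReal_subset p _ fun e he => not_isDiag_of_mem_edgeImage he, card_edgeImage]
  have hADp (f) : μ.real (A f ∩ D f) ≤ (p : ℝ) ^ e * δ := by
    have := measureReal_inter_subset p (edgeImage H f)
      (fun e he => not_isDiag_of_mem_edgeImage he) (D f) (hD f)
    rw [card_edgeImage] at this
    rw [Set.inter_comm, hA, this]
    exact mul_le_mul_of_nonneg_left (hδ f) (by positivity)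
  set N : ℝ := (Fintype.card (W ↪ V) : ℝ) with hN
  have hNlow : ((n : ℝ) / 2) ^ v ≤ N := by
    have h1 := Nat.pow_sub_le_descFactorial n v
    rw [hN, Fintype.card_embedding_eq, ← Nat.card_eq_fintype_card, ← Nat.card_eq_fintype_card]
    refine le_trans ?_ (Nat.cast_le.2 h1)
    push_cast
    gcongr
    rw [Nat.cast_sub (by omega)]
    push_cast
    have : (2 * v : ℝ) ≤ n := by exact_mod_cast hWV
    linarith
  have hn0 : (0 : ℝ) < n := by exact_mod_cast hV
  have hN0 : 0 < N := lt_of_lt_of_le (by positivity) hNlow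
  have hMA : ∑ f, μ.real (A f) = N * (p : ℝ) ^ e := by
    simp [hAp, hN]
  have hM0 : 0 < N * (p : ℝ) ^ e := by positivity
  rw [hset]
  refine (measureReal_forall_imp_le μ A D _ hM0 hMA).trans ?_
  refine add_le_add ?_ ?_
  · -- the pairs of copies, sorted by the set of vertices of the second that lie in the first
    have hAA (f g) : μ.real (A f ∩ A g) ≤
        (p : ℝ) ^ (2 * e) * ((p : ℝ) ^ (edgesIn H (g ⁻¹' Set.range f)).ncard)⁻¹ := by
      have h1 : A f ∩ A g = {G | ((edgeImage H f ∪ edgeImage H g : Finset (Sym2 V)) : Set (Sym2 V)) ⊆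
          G.edgeSet} := by
        ext G; simp [hA]
      rw [h1, hμ, measureReal_subset]
      · rw [← div_eq_mul_inv, le_div_iff₀ (by positivity), ← pow_add]
        exact pow_le_pow_of_le_one hp.le hp1 (two_mul_ncard_le_card_union H f g)
      · intro e he
        rcases Finset.mem_union.1 he with he | he <;> exact not_isDiag_of_mem_edgeImage he
    set S : Finset (Finset W) := Finset.univ.filter Finset.Nonempty with hS
    have hfin : ∑ᶠ J ∈ {J : Set W | J.Nonempty},
        ((n : ℝ) ^ J.ncard * (p : ℝ) ^ (edgesIn H J).ncard)⁻¹ =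
        ∑ J ∈ S, ((n : ℝ) ^ J.card * (p : ℝ) ^ (edgesIn H J).ncard)⁻¹ := by
      rw [finsum_mem_eq_finite_toFinset_sum _ (Set.toFinite _)]
      symm
      refine Finset.sum_bij (fun J _ => (J : Set W)) ?_ ?_ ?_ ?_
      · intro J hJ; simpa [hS] using hJ
      · intro J _ J' _ h; exact Finset.coe_injective h
      · intro J hJ
        refine ⟨J.toFinset, ?_, by simp⟩
        simpa [hS] using hJ
      · intro J _; simp
    have hsum : (∑ f, ∑ g, μ.real (A f ∩ A g)) - (N * (p : ℝ) ^ e) ^ 2 ≤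
        ∑ J ∈ S, N * (v ^ v * n ^ (v - J.card)) *
          ((p : ℝ) ^ (2 * e) * ((p : ℝ) ^ (edgesIn H J).ncard)⁻¹) := by
      have h1 (f g) : μ.real (A f ∩ A g) - (p : ℝ) ^ (2 * e) ≤
          ∑ J ∈ S, if (g ⁻¹' Set.range f) = (J : Set W) then
            (p : ℝ) ^ (2 * e) * ((p : ℝ) ^ (edgesIn H J).ncard)⁻¹ else 0 := by
        by_cases h : (g ⁻¹' Set.range f).Nonempty
        · have hmem : (g ⁻¹' Set.range f).toFinset ∈ S := by simpa [hS] using h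
          refine le_trans ?_ (Finset.single_le_sum (fun J _ => ?_) hmem)
          · rw [if_pos (by simp)]
            have := hAA f g
            have h2 : 0 ≤ (p : ℝ) ^ (2 * e) := by positivity
            simp only [Set.coe_toFinset]
            linarith
          · split_ifs <;> positivity
        · have h0 := hAA f g
          rw [Set.not_nonempty_iff_eq_empty] at h
          rw [h, edgesIn_empty] at h0
          simp only [Set.ncard_empty, pow_zero, inv_one, mul_one] at h0
          refine le_trans (sub_nonpos.2 h0) (Finset.sum_nonneg fun J _ => ?_)
          split_ifs <;> positivity
      have h2 : (N * (p : ℝ) ^ e) ^ 2 = ∑ f : W ↪ V, ∑ g : W ↪ V, (p : ℝ) ^ (2 * e) := by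
        simp only [Finset.sum_const, Finset.card_univ, nsmul_eq_mul, ← hN]
        ring
      rw [h2, ← Finset.sum_sub_distrib]
      simp only [← Finset.sum_sub_distrib]
      refine (Finset.sum_le_sum fun f _ => Finset.sum_le_sum fun g _ => h1 f g).trans ?_
      have h3 (f : W ↪ V) : ∑ g : W ↪ V, ∑ J ∈ S, (if (g ⁻¹' Set.range f) = (J : Set W) then
            (p : ℝ) ^ (2 * e) * ((p : ℝ) ^ (edgesIn H J).ncard)⁻¹ else 0) ≤
          ∑ J ∈ S, (v ^ v * n ^ (v - J.card) : ℝ) *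
            ((p : ℝ) ^ (2 * e) * ((p : ℝ) ^ (edgesIn H J).ncard)⁻¹) := by
        rw [Finset.sum_comm]
        refine Finset.sum_le_sum fun J hJ => ?_
        rw [← Finset.sum_filter, Finset.sum_const, nsmul_eq_mul]
        refine mul_le_mul_of_nonneg_right ?_ (by positivity)
        have hJv : J.card ≤ v := by
          rw [hv, Nat.card_eq_fintype_card]; exact Finset.card_le_univ J
        have hJne : J.Nonempty := by simpa [hS] using hJ
        have hv1 : 1 ≤ v := hJne.card_pos.trans_le hJv
        have h4 := card_filter_preimage_range_le f J
        rw [← Nat.card_eq_fintype_card, ← Nat.card_eq_fintype_card, ← hn, ← hv] at h4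
        refine (Nat.cast_le.2 h4).trans ?_
        push_cast
        gcongr
        exact_mod_cast hv1
      refine (Finset.sum_le_sum fun f _ => h3 f).trans ?_
      rw [Finset.sum_const, Finset.card_univ, nsmul_eq_mul, ← hN, Finset.mul_sum]
      refine le_of_eq (Finset.sum_congr rfl fun J _ => ?_)
      ring
    rw [hfin, mul_div_assoc]
    refine mul_le_mul_of_nonneg_left ?_ (by norm_num)
    rw [div_le_iff₀ (by positivity), Finset.mul_sum, Finset.sum_mul]
    refine hsum.trans (Finset.sum_le_sum fun J _ => ?_)
    have hJv : J.card ≤ v := by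
      rw [hv, Nat.card_eq_fintype_card]; exact Finset.card_le_univ J
    have hnv : (n : ℝ) ^ (v - J.card) = n ^ v * (n ^ J.card : ℝ)⁻¹ := by
      rw [← div_eq_mul_inv, eq_div_iff (by positivity), ← pow_add, Nat.sub_add_cancel hJv]
    have hNn : (n : ℝ) ^ v ≤ 2 ^ v * N := by
      rw [div_pow, div_le_iff₀ (by positivity)] at hNlow
      linarith
    rw [hnv, mul_inv, mul_pow]
    calc N * (v ^ v * (n ^ v * (n ^ J.card : ℝ)⁻¹)) *
          ((p : ℝ) ^ (2 * e) * ((p : ℝ) ^ (edgesIn H J).ncard)⁻¹)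
        = n ^ v * (N * v ^ v * (n ^ J.card : ℝ)⁻¹ *
          ((p : ℝ) ^ (2 * e) * ((p : ℝ) ^ (edgesIn H J).ncard)⁻¹)) := by ring
      _ ≤ (2 ^ v * N) * (N * v ^ v * (n ^ J.card : ℝ)⁻¹ *
          ((p : ℝ) ^ (2 * e) * ((p : ℝ) ^ (edgesIn H J).ncard)⁻¹)) := by gcongr
      _ = _ := by ring
  · rw [mul_div_assoc]
    refine mul_le_mul_of_nonneg_left ?_ (by norm_num)
    rw [div_le_iff₀ hM0]
    refine (Finset.sum_le_sum fun f _ => hADp f).trans_eq ?_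
    simp [hN]
    ring

/-- If the expected number of copies of every nonempty induced subgraph of `H` tends to infinity,
then `G(n, p)` contains, with high probability, a copy of `H` which is not bad, provided that the
badness of a given copy does not depend on its edges and has probability `o(1)`. -/
lemma tendsto_measureReal_exists_copy [Finite W] (p : ℕ → I) (H : SimpleGraph W)
    (hp : ∀ᶠ n in atTop, 0 < (p n : ℝ))
    (hH : ∀ J : Set W, J.Nonempty →
      Tendsto (fun n : ℕ => (n : ℝ) ^ J.ncard * (p n : ℝ) ^ (edgesIn H J).ncard) atTop atTop)
    (D : ∀ n, (W ↪ Fin n) → Set (SimpleGraph (Fin n)))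
    (hD : ∀ n f, IgnoresEdges (D n f) (edgeImage H f))
    (hD0 : ∀ δ > 0, ∀ᶠ n in atTop, ∀ f, (binomialRandom (Fin n) (p n)).real (D n f) ≤ δ) :
    Tendsto (fun n => (binomialRandom (Fin n) (p n)).real
      {G | ∃ f : W ↪ Fin n, (∀ a b, H.Adj a b → G.Adj (f a) (f b)) ∧ G ∉ D n f})
      atTop (𝓝 1) := by
  suffices h : Tendsto (fun n => (binomialRandom (Fin n) (p n)).real
      {G | ∀ f : W ↪ Fin n, (∀ a b, H.Adj a b → G.Adj (f a) (f b)) → G ∈ D n f})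
      atTop (𝓝 0) by
    have h1 := h.const_sub 1
    rw [sub_zero] at h1
    refine h1.congr fun n => ?_
    rw [← probReal_compl_eq_one_sub (Set.toFinite _).measurableSet]
    congr 1
    ext G
    simp
  have hsum : Tendsto (fun n : ℕ => 4 * ((2 * Nat.card W : ℝ) ^ Nat.card W *
      ∑ᶠ J ∈ {J : Set W | J.Nonempty},
      ((n : ℝ) ^ J.ncard * (p n : ℝ) ^ (edgesIn H J).ncard)⁻¹)) atTop (𝓝 0) := by
    have : Tendsto (fun n : ℕ => ∑ᶠ J ∈ {J : Set W | J.Nonempty},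
      ((n : ℝ) ^ J.ncard * (p n : ℝ) ^ (edgesIn H J).ncard)⁻¹) atTop (𝓝 0) := by
      simp_rw [finsum_mem_eq_finite_toFinset_sum _ (Set.toFinite {J : Set W | J.Nonempty})]
      rw [show (0 : ℝ) = ∑ J ∈ (Set.toFinite {J : Set W | J.Nonempty}).toFinset, 0 by simp]
      refine tendsto_finsetSum _ fun J hJ => (hH J ?_).inv_tendsto_atTop
      simpa using hJ
    simpa using (this.const_mul ((2 * Nat.card W : ℝ) ^ Nat.card W)).const_mul 4
  rw [Metric.tendsto_atTop]
  intro ε hε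
  rw [Metric.tendsto_atTop] at hsum
  obtain ⟨n₀, hn₀⟩ := hsum (ε / 2) (by positivity)
  obtain ⟨n₁, hn₁⟩ := eventually_atTop.1 ((hD0 (ε / 8) (by positivity)).and hp)
  refine ⟨max (max n₀ n₁) (2 * Nat.card W + 1), fun n hn => ?_⟩
  have h0 := hn₀ n (by omega)
  obtain ⟨h1, h2⟩ := hn₁ n (by omega)
  have h3 := measureReal_forall_copy_le (V := Fin n) (p n) h2 H (by simp; omega) (by simp; omega)
    (D n) (hD n) (ε / 8) h1
  rw [Nat.card_fin] at h3
  rw [Real.dist_eq, sub_zero] at h0 ⊢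
  rw [abs_of_nonneg measureReal_nonneg]
  have := le_abs_self (4 * ((2 * Nat.card W : ℝ) ^ Nat.card W *
      ∑ᶠ J ∈ {J : Set W | J.Nonempty},
      ((n : ℝ) ^ J.ncard * (p n : ℝ) ^ (edgesIn H J).ncard)⁻¹))
  linarith

end SecondMoment

/-! ### Joined large sets and the giant component -/

section LargeSets

variable {V : Type*}

/-- Any two disjoint sets of at least `η |V|` vertices are joined by an edge. -/
def LargeSetsJoined (G : SimpleGraph V) (η : ℝ) : Prop :=
  ∀ A B : Finset V, Disjoint A B → η * Nat.card V ≤ A.card → η * Nat.card V ≤ B.card →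
    ∃ a ∈ A, ∃ b ∈ B, G.Adj a b

lemma measureReal_not_largeSetsJoined_le [Finite V] (p : I) {η : ℝ} (hη : 0 ≤ η) :
    (binomialRandom V p).real {G | ¬ LargeSetsJoined G η} ≤
      4 ^ Nat.card V * Real.exp (-(p * (η * Nat.card V) ^ 2)) := by
  classical
  cases nonempty_fintype V
  set S : Finset (Finset V × Finset V) := Finset.univ.filter fun AB =>
    Disjoint AB.1 AB.2 ∧ η * Nat.card V ≤ AB.1.card ∧ η * Nat.card V ≤ AB.2.card with hS
  have hsub : {G : SimpleGraph V | ¬ LargeSetsJoined G η} ⊆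
      ⋃ AB ∈ S, {G | ∀ e ∈ (AB.1 ×ˢ AB.2).image (fun x => s(x.1, x.2)), e ∉ G.edgeSet} := by
    intro G hG
    simp only [LargeSetsJoined, Set.mem_ofPred_eq, not_forall, not_exists, not_and] at hG
    obtain ⟨A, B, hAB, hA, hB, h⟩ := hG
    refine Set.mem_biUnion (x := (A, B)) (Finset.mem_filter.2 ⟨Finset.mem_univ _, hAB, hA, hB⟩) ?_
    intro e he
    obtain ⟨⟨a, b⟩, hab, rfl⟩ := Finset.mem_image.1 he
    rw [Finset.mem_product] at hab
    exact h a hab.1 b hab.2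
  have hp1 : (0 : ℝ) ≤ 1 - p := sub_nonneg.2 p.2.2
  calc (binomialRandom V p).real {G | ¬ LargeSetsJoined G η}
      ≤ ∑ AB ∈ S, (binomialRandom V p).real
          {G | ∀ e ∈ (AB.1 ×ˢ AB.2).image (fun x => s(x.1, x.2)), e ∉ G.edgeSet} :=
        (measureReal_mono hsub (measure_ne_top _ _)).trans (measureReal_biUnion_finset_le _ _)
    _ ≤ ∑ AB ∈ S, Real.exp (-(p * (η * Nat.card V) ^ 2)) := by
        refine Finset.sum_le_sum fun AB hAB => ?_
        obtain ⟨hd, hA, hB⟩ : Disjoint AB.1 AB.2 ∧ η * Nat.card V ≤ AB.1.card ∧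
          η * Nat.card V ≤ AB.2.card := by simpa [hS] using hAB
        rw [measureReal_disjoint]
        · rw [Finset.card_image_of_injOn, Finset.card_product]
          · calc (1 - p : ℝ) ^ (AB.1.card * AB.2.card)
                ≤ Real.exp (-p) ^ (AB.1.card * AB.2.card) := by
                  gcongr
                  exact Real.one_sub_le_exp_neg _
              _ = Real.exp (-(p * (AB.1.card * AB.2.card))) := by
                  rw [← Real.exp_nat_mul]; push_cast; ring_nf
              _ ≤ _ := by
                  gcongr
                  · exact p.2.1
                  · rw [sq]; gcongr
          · rintro ⟨a, b⟩ hab ⟨a', b'⟩ hab' h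
            simp only [Finset.coe_product, Set.mem_prod, Finset.mem_coe] at hab hab'
            simp only [Sym2.eq_iff] at h
            rcases h with ⟨rfl, rfl⟩ | ⟨rfl, rfl⟩
            · rfl
            · exact absurd hab'.2 (Finset.disjoint_left.1 hd hab.1)
        · intro e he
          obtain ⟨⟨a, b⟩, hab, rfl⟩ := Finset.mem_image.1 he
          rw [Finset.mem_product] at hab
          simp only [Sym2.mk_isDiag_iff]
          rintro rfl
          exact Finset.disjoint_left.1 hd hab.1 hab.2
    _ = S.card * Real.exp (-(p * (η * Nat.card V) ^ 2)) := by simp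
    _ ≤ _ := by
        gcongr
        have h1 : S.card ≤ Fintype.card (Finset V × Finset V) := Finset.card_le_univ _
        rw [Fintype.card_prod, Fintype.card_finset, ← mul_pow, ← Nat.card_eq_fintype_card] at h1
        exact_mod_cast h1

lemma tendsto_measureReal_not_largeSetsJoined (p : ℕ → I)
    (hp : Tendsto (fun n : ℕ => (n : ℝ) * p n) atTop atTop) {η : ℝ} (hη : 0 < η) :
    Tendsto (fun n => (binomialRandom (Fin n) (p n)).real {G | ¬ LargeSetsJoined G η})
      atTop (𝓝 0) := by
  have he : 4 * Real.exp (-2) < 1 := by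
    have h1 : (2 : ℝ) < Real.exp 1 := by
      have := Real.exp_one_gt_d9; linarith
    have h2 : Real.exp 2 = Real.exp 1 * Real.exp 1 := by rw [← Real.exp_add]; norm_num
    rw [Real.exp_neg, ← div_eq_mul_inv, div_lt_one (Real.exp_pos _), h2]
    nlinarith
  refine squeeze_zero' (.of_forall fun _ => measureReal_nonneg) ?_
    (tendsto_pow_atTop_nhds_zero_of_lt_one (by positivity) he)
  filter_upwards [hp.eventually_ge_atTop (2 / η ^ 2)] with n hn
  refine (measureReal_not_largeSetsJoined_le (p n) hη.le).trans ?_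
  rw [mul_pow 4, ← Real.exp_nat_mul, Nat.card_fin]
  gcongr
  rw [div_le_iff₀ (by positivity)] at hn
  nlinarith [mul_le_mul_of_nonneg_left hn (Nat.cast_nonneg (α := ℝ) n)]

lemma LargeSetsJoined.not_colorable [Finite V] {G : SimpleGraph V} {N : ℕ} (hN : 0 < N)
    (hG : LargeSetsJoined G (1 / (4 * N))) (hV : 4 * N ≤ Nat.card V) : ¬ G.Colorable N := by
  classical
  cases nonempty_fintype V
  rintro ⟨C⟩
  set n := Nat.card V with hn
  have hN' : (0 : ℝ) < N := by exact_mod_cast hN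
  have : Nonempty (Fin N) := ⟨⟨0, hN⟩⟩
  have hcard : Fintype.card (Fin N) • (n / N : ℝ) ≤ Fintype.card V := by
    rw [nsmul_eq_mul, Fintype.card_fin, hn, Nat.card_eq_fintype_card]
    field_simp
    exact le_rfl
  obtain ⟨k, hk⟩ := Fintype.exists_le_card_fiber_of_nsmul_le_card C hcard
  set S : Finset V := Finset.univ.filter fun v => C v = k with hS
  set m := ⌈(1 / (4 * N) : ℝ) * n⌉₊ with hm
  have hm1 : (m : ℝ) < 1 / (4 * N) * n + 1 := Nat.ceil_lt_add_one (by positivity)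
  have hm2 : (1 / (4 * N) : ℝ) * n ≤ m := Nat.le_ceil _
  have hVN : (4 * N : ℝ) ≤ n := by exact_mod_cast hV
  have hmS : (m : ℝ) + m ≤ S.card := by
    refine le_trans ?_ hk
    have h1 : (1 : ℝ) ≤ 1 / (4 * N) * n := by
      rw [div_mul_eq_mul_div, one_mul, le_div_iff₀ (by positivity)]; linarith
    have h2 : (n : ℝ) / N = 4 * (1 / (4 * N) * n) := by field_simp
    linarith
  have hmS' : m + m ≤ S.card := by exact_mod_cast hmS
  obtain ⟨A, hAS, hA⟩ := Finset.exists_subset_card_eq (s := S) (n := m) (by omega)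
  obtain ⟨B, hBS, hB⟩ := Finset.exists_subset_card_eq (s := S \ A) (n := m)
    (by rw [Finset.card_sdiff_of_subset hAS]; omega)
  obtain ⟨a, ha, b, hb, hab⟩ := hG A B
    (Finset.disjoint_left.2 fun x hx hx' => (Finset.mem_sdiff.1 (hBS hx')).2 hx)
    (by rw [hA]; exact hm2) (by rw [hB]; exact hm2)
  have h1 : C a = k := by simpa [hS] using hAS ha
  have h2 : C b = k := by simpa [hS] using (Finset.mem_sdiff.1 (hBS hb)).1
  exact C.valid hab (h1.trans h2.symm)

lemma tendsto_measureReal_colorable (p : ℕ → I)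
    (hp : Tendsto (fun n : ℕ => (n : ℝ) * p n) atTop atTop) (N : ℕ) :
    Tendsto (fun n => (binomialRandom (Fin n) (p n)).real {G | G.Colorable N}) atTop (𝓝 0) := by
  refine squeeze_zero' (.of_forall fun _ => measureReal_nonneg) ?_
    (tendsto_measureReal_not_largeSetsJoined p hp (η := 1 / (4 * (N + 1 : ℕ))) (by positivity))
  filter_upwards [eventually_ge_atTop (4 * (N + 1))] with n hn
  refine measureReal_mono fun G hG h => ?_
  exact h.not_colorable N.succ_pos (by simpa using hn) (hG.mono N.le_succ)

end LargeSets

section Giant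

variable {V : Type*}

/-- The edges of `G` inside `U`, as a graph on the whole vertex set. -/
def inside (G : SimpleGraph V) (U : Finset V) : SimpleGraph V where
  Adj a b := G.Adj a b ∧ a ∈ U ∧ b ∈ U
  symm := ⟨fun _ _ h => ⟨h.1.symm, h.2.2, h.2.1⟩⟩
  loopless := ⟨fun _ h => h.1.ne rfl⟩

lemma inside_adj {G : SimpleGraph V} {U : Finset V} {a b : V} :
    (inside G U).Adj a b ↔ G.Adj a b ∧ a ∈ U ∧ b ∈ U := Iff.rfl

lemma inside_le (G : SimpleGraph V) (U : Finset V) : inside G U ≤ G := fun _ _ h => h.1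

/-- More than half of all vertices can be reached from `v` within `U`. -/
def IsLargeIn (G : SimpleGraph V) (U : Finset V) (v : V) : Prop :=
  Nat.card V < 2 * {u | (inside G U).Reachable v u}.ncard

lemma mem_of_reachable_inside {G : SimpleGraph V} {U A : Finset V}
    (hA : ∀ a ∈ A, ∀ b ∈ U, G.Adj a b → b ∈ A) {v u : V} (hv : v ∈ A)
    (h : (inside G U).Reachable v u) : u ∈ A := by
  obtain ⟨w⟩ := h
  induction w with
  | nil => exact hv
  | cons h _ ih => exact ih (hA _ hv _ h.2.2 h.1)

/-- If large sets are joined, then all but few vertices of `U` lie in one large component. -/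
lemma LargeSetsJoined.card_not_isLargeIn_le [Fintype V] [DecidableEq V] {G : SimpleGraph V} {η : ℝ}
    (hη : 0 < η) (hG : LargeSetsJoined G η) (U : Finset V)
    (hU : (Nat.card V : ℝ) / 2 + 2 * (η * Nat.card V) < U.card)
    [DecidablePred fun v => ¬ IsLargeIn G U v] :
    ((U.filter fun v => ¬ IsLargeIn G U v).card : ℝ) ≤ 2 * (η * Nat.card V) := by
  classical
  set n := Nat.card V with hn
  -- a smallest union of components of `G[U]` with at least `η n` vertices
  set S := U.powerset.filter fun A =>
    (∀ a ∈ A, ∀ b ∈ U, G.Adj a b → b ∈ A) ∧ η * n ≤ A.card with hS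
  have hSne : S.Nonempty := by
    refine ⟨U, ?_⟩
    simp only [hS, Finset.mem_filter, Finset.mem_powerset, Finset.Subset.refl, true_and]
    refine ⟨fun _ _ b hb _ => hb, ?_⟩
    have : (0 : ℝ) ≤ η * n := by positivity
    have : (0 : ℝ) ≤ n := by positivity
    linarith
  obtain ⟨A, hAS, hAmin⟩ := S.exists_min_image Finset.card hSne
  simp only [hS, Finset.mem_filter, Finset.mem_powerset] at hAS
  obtain ⟨hAU, hAcl, hAη⟩ := hAS
  have hUA : ((U \ A).card : ℝ) < η * n := by
    by_contra! h
    obtain ⟨a, ha, b, hb, hab⟩ := hG A (U \ A) Finset.disjoint_sdiff hAη h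
    rw [Finset.mem_sdiff] at hb
    exact hb.2 (hAcl a ha b hb.1 hab)
  have hUcard : ((U \ A).card : ℝ) + A.card = U.card := by
    exact_mod_cast Finset.card_sdiff_add_card_eq_card hAU
  have hn0 : (0 : ℝ) ≤ n := by positivity
  have hηn : (0 : ℝ) ≤ η * n := by positivity
  have hA0 : A.Nonempty := by
    rw [← Finset.card_pos, ← Nat.cast_pos (α := ℝ)]
    linarith
  obtain ⟨v, hv⟩ := hA0
  set C := U.filter fun u => (inside G U).Reachable v u with hC
  have hCA : C ⊆ A := fun u hu => mem_of_reachable_inside hAcl hv (Finset.mem_filter.1 hu).2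
  have hvC : v ∈ C := Finset.mem_filter.2 ⟨hAU hv, Reachable.refl v⟩
  have hAC : ((A \ C).card : ℝ) < η * n := by
    by_contra! h
    have hmem : A \ C ∈ S := by
      simp only [hS, Finset.mem_filter, Finset.mem_powerset]
      refine ⟨Finset.sdiff_subset.trans hAU, fun a ha b hb hab => ?_, h⟩
      rw [Finset.mem_sdiff] at ha ⊢
      refine ⟨hAcl a ha.1 b hb hab, fun hbC => ha.2 (Finset.mem_filter.2 ⟨hAU ha.1, ?_⟩)⟩
      refine (Finset.mem_filter.1 hbC).2.trans (Adj.reachable ?_)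
      exact ⟨hab.symm, hb, hAU ha.1⟩
    have h1 := hAmin _ hmem
    have h2 := Finset.card_sdiff_add_card_eq_card hCA
    have h3 : 0 < C.card := Finset.card_pos.2 ⟨v, hvC⟩
    omega
  have hACcard : ((A \ C).card : ℝ) + C.card = A.card := by
    exact_mod_cast Finset.card_sdiff_add_card_eq_card hCA
  have hlarge (u : V) (hu : u ∈ C) : IsLargeIn G U u := by
    have hCu : (C : Set V) ⊆ {x | (inside G U).Reachable u x} := fun x hx =>
      (Finset.mem_filter.1 hu).2.symm.trans (Finset.mem_filter.1 hx).2
    have h1 := Set.ncard_le_ncard hCu (Set.toFinite _)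
    rw [Set.ncard_coe_finset] at h1
    have h2 : (n : ℝ) < 2 * C.card := by linarith
    have h3 : n < 2 * C.card := by exact_mod_cast h2
    unfold IsLargeIn
    omega
  have hsub : (U.filter fun v => ¬ IsLargeIn G U v) ⊆ (U \ A) ∪ (A \ C) := by
    intro u hu
    rw [Finset.mem_filter] at hu
    have : u ∉ C := fun h => hu.2 (hlarge u h)
    by_cases huA : u ∈ A <;> simp [huA, this, hu.1]
  have h1 := (Finset.card_le_card hsub).trans (Finset.card_union_le _ _)
  have h2 : ((U.filter fun v => ¬ IsLargeIn G U v).card : ℝ) ≤ (U \ A).card + (A \ C).card := by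
    exact_mod_cast h1
  linarith

lemma isLargeIn_map_iff [DecidableEq V] (G : SimpleGraph V) (U : Finset V) (τ : V ≃ V)
    (hτ : ∀ x, τ x ∈ U ↔ x ∈ U) (v : V) :
    IsLargeIn (G.map τ.toEmbedding) U (τ v) ↔ IsLargeIn G U v := by
  have h1 : inside (G.map τ.toEmbedding) U = (inside G U).map τ.toEmbedding := by
    ext a b
    obtain ⟨a, rfl⟩ := τ.surjective a
    obtain ⟨b, rfl⟩ := τ.surjective b
    have key (G : SimpleGraph V) : (G.map τ.toEmbedding).Adj (τ a) (τ b) ↔ G.Adj a b :=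
      map_adj_apply
    simp only [inside_adj, key, hτ]
  have h2 : {u | ((inside G U).map τ.toEmbedding).Reachable (τ v) u} =
      τ '' {u | (inside G U).Reachable v u} := by
    ext u
    simp only [Set.mem_ofPred_eq, Set.mem_image]
    have key (a b : V) : ((inside G U).map τ.toEmbedding).Reachable (τ a) (τ b) ↔
        (inside G U).Reachable a b :=
      (Iso.map τ (inside G U)).reachable_iff
    constructor
    · intro h
      refine ⟨τ.symm u, ?_, by simp⟩
      rw [← key]; simpa using h
    · rintro ⟨x, hx, rfl⟩
      exact (key v x).2 hx
  unfold IsLargeIn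
  rw [h1, h2, Set.ncard_image_of_injective _ τ.injective]

/-- By symmetry all vertices of `U` have the same probability of not being in a large component of
`G[U]`, and on average few vertices of `U` are not. -/
lemma measureReal_not_isLargeIn_le [Finite V] (p : I) {η : ℝ} (hη : 0 < η) (U : Finset V)
    (hU : (Nat.card V : ℝ) / 2 + 2 * (η * Nat.card V) < U.card) (v : V) (hv : v ∈ U) :
    (binomialRandom V p).real {G | ¬ IsLargeIn G U v} ≤
      4 * η + 2 * (binomialRandom V p).real {G | ¬ LargeSetsJoined G η} := by
  classical
  cases nonempty_fintype V
  set μ := binomialRandom V p with hμ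
  set n := Nat.card V with hn
  have hsymm (u : V) (hu : u ∈ U) : μ.real {G | ¬ IsLargeIn G U u} =
      μ.real {G | ¬ IsLargeIn G U v} := by
    rw [← measureReal_preimage_map p (Equiv.swap v u) {G | ¬ IsLargeIn G U u}]
    congr 1
    ext G
    have := isLargeIn_map_iff G U (Equiv.swap v u) (fun x => by
      rcases eq_or_ne x v with rfl | h1
      · simp [hv, hu]
      rcases eq_or_ne x u with rfl | h2
      · simp [hv, hu]
      rw [Equiv.swap_apply_of_ne_of_ne h1 h2]) v
    rw [Equiv.swap_apply_left] at this
    simp only [Set.mem_ofPred_eq, this]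
  have hsum : (U.card : ℝ) * μ.real {G | ¬ IsLargeIn G U v} ≤
      2 * (η * n) + U.card * μ.real {G | ¬ LargeSetsJoined G η} := by
    have h1 : (U.card : ℝ) * μ.real {G | ¬ IsLargeIn G U v} =
        ∑ u ∈ U, μ.real {G | ¬ IsLargeIn G U u} := by
      rw [Finset.sum_congr rfl hsymm]; simp
    have hmeas (S : Set (SimpleGraph V)) : MeasurableSet S := (Set.toFinite S).measurableSet
    have hind (S : Set (SimpleGraph V)) :
        ∫ G, S.indicator (1 : SimpleGraph V → ℝ) G ∂μ = μ.real S :=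
      integral_indicator_one (hmeas S)
    have hint (f : SimpleGraph V → ℝ) : Integrable f μ := Integrable.of_finite
    have h2 : ∑ u ∈ U, μ.real {G | ¬ IsLargeIn G U u} =
        ∫ G, ∑ u ∈ U, ({G | ¬ IsLargeIn G U u} : Set _).indicator (1 : SimpleGraph V → ℝ) G ∂μ := by
      rw [integral_finsetSum _ fun i _ => hint _]
      simp only [hind]
    have h3 : 2 * (η * n) + U.card * μ.real {G | ¬ LargeSetsJoined G η} =
        ∫ G, (2 * (η * n) + U.card *
          ({G | ¬ LargeSetsJoined G η} : Set _).indicator (1 : SimpleGraph V → ℝ) G) ∂μ := by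
      rw [integral_add (hint _) (hint _), integral_const_mul (U.card : ℝ), hind]
      simp
    rw [h1, h2, h3]
    refine integral_mono (hint _) (hint _) fun G => ?_
    have h4 : ∑ u ∈ U, ({G | ¬ IsLargeIn G U u} : Set _).indicator (1 : SimpleGraph V → ℝ) G =
        (U.filter fun u => ¬ IsLargeIn G U u).card := by
      rw [Finset.card_filter]
      push_cast
      refine Finset.sum_congr rfl fun u _ => ?_
      simp [Set.indicator_apply]
    simp only [h4]
    by_cases hG : LargeSetsJoined G η
    · have := hG.card_not_isLargeIn_le hη U hU
      simpa [hG, hn] using this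
    · have h5 : ((U.filter fun u => ¬ IsLargeIn G U u).card : ℝ) ≤ U.card := by
        exact_mod_cast Finset.card_filter_le _ _
      have h6 : 0 ≤ 2 * (η * n) := by positivity
      simp [hG]
      linarith
  have hn0 : (0 : ℝ) ≤ n := by positivity
  have hηn : (0 : ℝ) ≤ η * n := by positivity
  have hUpos : (0 : ℝ) < U.card := by linarith
  have hP : 0 ≤ μ.real {G | ¬ LargeSetsJoined G η} := measureReal_nonneg
  have h7 : 2 * (η * n) ≤ U.card * (4 * η) := by nlinarith
  refine le_of_mul_le_mul_left ?_ hUpos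
  nlinarith [mul_nonneg hUpos.le hP]

/-- The event that some vertex of the copy `f` of `H` fails to be in a large component of the graph
from which all other vertices of this copy were removed. -/
def someVertexSmall {W V : Type*} [Fintype V] [DecidableEq V] [Fintype W] (f : W ↪ V) :
    Set (SimpleGraph V) :=
  {G | ∃ w, ¬ IsLargeIn G (insert (f w) (Finset.univ.map f)ᶜ) (f w)}

lemma ignoresEdges_someVertexSmall {W V : Type*} [Fintype V] [DecidableEq V] [Fintype W]
    (H : SimpleGraph W) (f : W ↪ V) : IgnoresEdges (someVertexSmall f) (edgeImage H f) := by
  intro G G' h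
  refine exists_congr fun w => not_congr ?_
  have : inside G (insert (f w) (Finset.univ.map f)ᶜ) =
      inside G' (insert (f w) (Finset.univ.map f)ᶜ) := by
    ext a b
    refine and_congr_left fun hab => h s(a, b) ?_
    intro he
    obtain ⟨e', he', heq⟩ := mem_edgeImage.1 he
    induction e' with
    | _ x y =>
      rw [Sym2.map_mk, Sym2.eq_iff] at heq
      have hne : x ≠ y := H.ne_of_adj he'
      have hx (z : W) (hz : f z ∈ insert (f w) (Finset.univ.map f)ᶜ) : z = w := by
        simpa using hz
      apply hne
      rcases heq with ⟨rfl, rfl⟩ | ⟨rfl, rfl⟩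
      · rw [hx x hab.1, hx y hab.2]
      · rw [hx x hab.2, hx y hab.1]
  unfold IsLargeIn
  rw [this]

lemma reachable_of_notMem_someVertexSmall {W V : Type*} [Fintype V] [DecidableEq V] [Fintype W]
    {f : W ↪ V} {G : SimpleGraph V} (h : G ∉ someVertexSmall f) (a b : W) :
    G.Reachable (f a) (f b) := by
  have key (w : W) : Nat.card V < 2 * {u | G.Reachable (f w) u}.ncard := by
    have h1 : IsLargeIn G (insert (f w) (Finset.univ.map f)ᶜ) (f w) := by
      by_contra h2
      exact h ⟨w, h2⟩
    refine lt_of_lt_of_le h1 (Nat.mul_le_mul_left _ (Set.ncard_le_ncard ?_ (Set.toFinite _)))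
    exact fun u hu => Reachable.mono (inside_le _ _) hu
  by_contra hab
  have hdisj : Disjoint {u | G.Reachable (f a) u} {u | G.Reachable (f b) u} :=
    Set.disjoint_left.2 fun u hu hu' => hab (Reachable.trans hu (Reachable.symm hu'))
  have h1 := Set.ncard_union_eq hdisj (Set.toFinite _) (Set.toFinite _)
  have h2 := Set.ncard_le_card ({u | G.Reachable (f a) u} ∪ {u | G.Reachable (f b) u})
  have := key a
  have := key b
  omega

/-- For `p ≫ 1 / n`, if the expected number of copies of every nonempty induced subgraph of `H`
tends to infinity, then `G(n, p)` contains with high probability a copy of `H` inside a single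
component. -/
lemma tendsto_measureReal_exists_copy_reachable {W : Type*} [Finite W] (p : ℕ → I)
    (H : SimpleGraph W) (hp0 : ∀ᶠ n in atTop, 0 < (p n : ℝ))
    (hp : Tendsto (fun n : ℕ => (n : ℝ) * p n) atTop atTop)
    (hH : ∀ J : Set W, J.Nonempty →
      Tendsto (fun n : ℕ => (n : ℝ) ^ J.ncard * (p n : ℝ) ^ (edgesIn H J).ncard) atTop atTop) :
    Tendsto (fun n => (binomialRandom (Fin n) (p n)).real
      {G | ∃ f : Copy H G, ∀ a b, G.Reachable (f a) (f b)}) atTop (𝓝 1) := by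
  classical
  cases nonempty_fintype W
  have h := tendsto_measureReal_exists_copy p H hp0 hH (fun n f => someVertexSmall f)
    (fun n f => ignoresEdges_someVertexSmall H f) ?_
  · refine tendsto_of_tendsto_of_tendsto_of_le_of_le h tendsto_const_nhds ?_
      (fun n => measureReal_le_one)
    intro n
    refine measureReal_mono ?_
    rintro G ⟨f, hf, hG⟩
    exact ⟨copyOfInjective f f.injective hf, reachable_of_notMem_someVertexSmall hG⟩
  · intro δ hδ
    set v : ℝ := Fintype.card W + 1 with hv
    have hv0 : 0 < v := by positivity
    set η : ℝ := min (δ / (8 * v)) (1 / 16) with hηdef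
    have hη : 0 < η := by positivity
    have hη1 : η ≤ δ / (8 * v) := min_le_left _ _
    have hη2 : η ≤ 1 / 16 := min_le_right _ _
    have hJ := (tendsto_measureReal_not_largeSetsJoined p hp hη).eventually_le_const
      (show (0 : ℝ) < δ / (4 * v) by positivity)
    filter_upwards [hJ, eventually_gt_atTop (4 * Fintype.card W)] with n hn hnW f
    have hsub : someVertexSmall f ⊆ ⋃ w, {G | ¬ IsLargeIn G
        (insert (f w) (Finset.univ.map f)ᶜ) (f w)} := by
      rintro G ⟨w, hw⟩
      exact Set.mem_iUnion.2 ⟨w, hw⟩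
    have hstep (w : W) : (binomialRandom (Fin n) (p n)).real {G | ¬ IsLargeIn G
        (insert (f w) (Finset.univ.map f)ᶜ) (f w)} ≤ δ / v := by
      refine (measureReal_not_isLargeIn_le (p n) hη _ ?_ (f w)
        (Finset.mem_insert_self _ _)).trans ?_
      · rw [Finset.card_insert_of_notMem (by simp), Finset.card_compl, Finset.card_map,
          Finset.card_univ, Fintype.card_fin, Nat.card_fin]
        push_cast [Nat.cast_sub (show Fintype.card W ≤ n by omega)]
        have h1 : (4 * Fintype.card W : ℝ) < n := by exact_mod_cast hnW
        have h2 : (0 : ℝ) ≤ n := by positivity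
        nlinarith
      · have : δ / v = 4 * (δ / (8 * v)) + 2 * (δ / (4 * v)) := by field_simp; ring
        rw [this]
        gcongr
    refine ((measureReal_mono hsub).trans (measureReal_iUnion_fintype_le _)).trans ?_
    refine (Finset.sum_le_sum fun w _ => hstep w).trans ?_
    rw [Finset.sum_const, Finset.card_univ, nsmul_eq_mul, mul_div_assoc', div_le_iff₀ hv0, hv]
    nlinarith

end Giant

/-! ### Graphs of large chromatic number and rainbow trees -/

section Coloring

variable {V : Type*}

/-- There is a proper colouring with `N` colours of the subgraph induced by `R`. -/
def ColorableOn (G : SimpleGraph V) (R : Finset V) (N : ℕ) : Prop :=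
  ∃ f : V → ℕ, (∀ v ∈ R, f v < N) ∧ ∀ u ∈ R, ∀ v ∈ R, G.Adj u v → f u ≠ f v

lemma ColorableOn.union [DecidableEq V] {G : SimpleGraph V} {R S : Finset V} {N M : ℕ}
    (hR : ColorableOn G R N) (hS : ColorableOn G S M) : ColorableOn G (R ∪ S) (N + M) := by
  obtain ⟨f, hf, hf'⟩ := hR
  obtain ⟨g, hg, hg'⟩ := hS
  refine ⟨fun v => if v ∈ R then f v else N + g v, fun v hv => ?_, fun u hu v hv huv => ?_⟩
  · by_cases h : v ∈ R
    · simp only [h, if_true]; have := hf v h; omega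
    · have := hg v ((Finset.mem_union.1 hv).resolve_left h)
      simp only [h, if_false]; omega
  · by_cases h1 : u ∈ R <;> by_cases h2 : v ∈ R <;> simp only [h1, h2, if_true, if_false]
    · exact hf' u h1 v h2 huv
    · have := hf u h1; omega
    · have := hf v h2; omega
    · have := hg' u ((Finset.mem_union.1 hu).resolve_left h1) v
        ((Finset.mem_union.1 hv).resolve_left h2) huv
      omega

lemma ColorableOn.colorable [Fintype V] {G : SimpleGraph V} {N : ℕ}
    (h : ColorableOn G Finset.univ N) : G.Colorable N := by
  obtain ⟨f, hf, hf'⟩ := h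
  exact ⟨Coloring.mk (fun v => ⟨f v, hf v (Finset.mem_univ v)⟩) fun {u v} huv h =>
    hf' u (Finset.mem_univ _) v (Finset.mem_univ _) huv (by simpa using h)⟩

/-- A graph which can be oriented with all outdegrees at most `D` is `(2 D + 1)`-colourable: every
set of vertices spans a vertex of degree at most `2 D`. -/
lemma colorableOn_of_orientation [DecidableEq V] {G : SimpleGraph V} {D : ℕ} (out : V → Finset V)
    (hout : ∀ v, (out v).card ≤ D) (R : Finset V)
    (hG : ∀ u ∈ R, ∀ v ∈ R, G.Adj u v → v ∈ out u ∨ u ∈ out v) :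
    ColorableOn G R (2 * D + 1) := by
  classical
  induction R using Finset.strongInduction with
  | H R ih =>
    rcases R.eq_empty_or_nonempty with rfl | hne
    · exact ⟨fun _ => 0, by simp, by simp⟩
    have hsum : ∑ v ∈ R, (R.filter fun w => w ∈ out v ∨ v ∈ out w).card ≤ ∑ v ∈ R, 2 * D := by
      have h1 (v : V) : (R.filter fun w => w ∈ out v ∨ v ∈ out w).card ≤
          D + (R.filter fun w => v ∈ out w).card := by
        rw [Finset.filter_or]
        refine (Finset.card_union_le _ _).trans (Nat.add_le_add_right ?_ _)
        refine le_trans (Finset.card_le_card fun w hw => ?_) (hout v)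
        exact (Finset.mem_filter.1 hw).2
      have h2 : ∑ v ∈ R, (R.filter fun w => v ∈ out w).card =
          ∑ w ∈ R, (R.filter fun v => v ∈ out w).card :=
        Finset.sum_card_bipartiteAbove_eq_sum_card_bipartiteBelow fun v w => v ∈ out w
      have h3 : ∑ w ∈ R, (R.filter fun v => v ∈ out w).card ≤ ∑ w ∈ R, D :=
        Finset.sum_le_sum fun w _ =>
          (Finset.card_le_card fun v hv => (Finset.mem_filter.1 hv).2).trans (hout w)
      refine (Finset.sum_le_sum fun v _ => h1 v).trans ?_
      rw [Finset.sum_add_distrib, h2]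
      refine (Nat.add_le_add_left h3 _).trans ?_
      simp only [Finset.sum_const, smul_eq_mul]
      exact le_of_eq (by ring)
    obtain ⟨v, hv, hdeg⟩ := Finset.exists_le_of_sum_le hne hsum
    obtain ⟨f, hf, hf'⟩ := ih (R.erase v) (Finset.erase_ssubset hv)
      fun a ha b hb => hG a (Finset.mem_of_mem_erase ha) b (Finset.mem_of_mem_erase hb)
    set T := (R.filter fun w => w ∈ out v ∨ v ∈ out w).image f with hT
    obtain ⟨k, hk, hkT⟩ : ∃ k ∈ Finset.range (2 * D + 1), k ∉ T := by
      refine Finset.exists_mem_notMem_of_card_lt_card ?_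
      rw [Finset.card_range]
      exact Nat.lt_succ_of_le (Finset.card_image_le.trans hdeg)
    have hkv (w : V) (hw : w ∈ R) (h : w ∈ out v ∨ v ∈ out w) : f w ≠ k := by
      rintro rfl
      exact hkT (Finset.mem_image_of_mem _ (Finset.mem_filter.2 ⟨hw, h⟩))
    refine ⟨Function.update f v k, fun w hw => ?_, fun a ha b hb hab => ?_⟩
    · by_cases h : w = v
      · subst h; simpa using hk
      · simpa [h] using hf w (Finset.mem_erase.2 ⟨h, hw⟩)
    · have hor := hG a ha b hb hab
      by_cases h1 : a = v <;> by_cases h2 : b = v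
      · exact absurd (h1.trans h2.symm) hab.ne
      · subst h1
        simpa [h2] using (hkv b hb hor).symm
      · subst h2
        simpa [h1] using hkv a ha hor.symm
      · simpa [h1, h2] using hf' a (Finset.mem_erase.2 ⟨h1, ha⟩) b (Finset.mem_erase.2 ⟨h2, hb⟩) hab

end Coloring

section RainbowTree

variable {V : Type*}

/-- Suppose that the edges of every colour can be covered by `h` vertices. Then the vertices which
see at most `d` colours inside `R` span a graph of bounded chromatic number: orient every edge
towards an endpoint in the cover of its colour. -/
lemma colorableOn_few_colors [DecidableEq V] {G : SimpleGraph V} [DecidableRel G.Adj]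
    (c : Sym2 V → ℕ) {h : ℕ} (S : ℕ → Finset V) (hS : ∀ k, (S k).card ≤ h)
    (hcov : ∀ u v, G.Adj u v → u ∈ S (c s(u, v)) ∨ v ∈ S (c s(u, v))) (R : Finset V) (d : ℕ) :
    ColorableOn G (R.filter fun v => ((R.filter (G.Adj v)).image fun w => c s(v, w)).card ≤ d)
      (2 * (d * h) + 1) := by
  set K : V → Finset ℕ := fun v => (R.filter (G.Adj v)).image fun w => c s(v, w) with hK
  refine colorableOn_of_orientation (fun v => if (K v).card ≤ d then (K v).biUnion S else ∅) ?_ _ ?_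
  · intro v
    by_cases hv : (K v).card ≤ d
    · simp only [hv, if_true]
      exact Finset.card_biUnion_le.trans
        ((Finset.sum_le_card_nsmul _ _ h fun k _ => hS k).trans (by simpa using Nat.mul_le_mul_right h hv))
    · simp [hv]
  · intro u hu v hv huv
    rw [Finset.mem_filter] at hu hv
    have hu2 : (K u).card ≤ d := hu.2
    have hv2 : (K v).card ≤ d := hv.2
    have h1 : c s(u, v) ∈ K u :=
      Finset.mem_image.2 ⟨v, Finset.mem_filter.2 ⟨hv.1, huv⟩, rfl⟩
    have h2 : c s(u, v) ∈ K v :=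
      Finset.mem_image.2 ⟨u, Finset.mem_filter.2 ⟨hu.1, huv.symm⟩, by rw [Sym2.eq_swap]⟩
    simp only [hu2, hv2, if_true, Finset.mem_biUnion]
    rcases hcov u v huv with h | h
    · exact Or.inr ⟨_, h2, h⟩
    · exact Or.inl ⟨_, h1, h⟩

/-- If the edges of every colour can be covered by `h` vertices and the chromatic number is large,
then there is a rainbow copy of any given tree. By induction on the tree, with a leaf removed, a
rainbow copy of the smaller tree can be found on the vertices that see many colours; the attachment
vertex of the leaf then has an edge of a new colour. -/
lemma exists_rainbow_tree (h m : ℕ) : ∃ N : ℕ, ∀ (W : Type*) [Finite W] (T : SimpleGraph W),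
    T.IsTree → Nat.card W = m + 1 → ∀ {V : Type*} [Finite V] (G : SimpleGraph V) (c : Sym2 V → ℕ)
      (S : ℕ → Finset V), (∀ k, (S k).card ≤ h) →
      (∀ u v, G.Adj u v → u ∈ S (c s(u, v)) ∨ v ∈ S (c s(u, v))) →
      ∀ R : Finset V, ¬ ColorableOn G R N →
      ∃ f : W ↪ V, (∀ w, f w ∈ R) ∧ (∀ a b, T.Adj a b → G.Adj (f a) (f b)) ∧
        ∀ e ∈ T.edgeSet, ∀ e' ∈ T.edgeSet, c (e.map f) = c (e'.map f) → e = e' := by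
  classical
  induction m with
  | zero =>
    refine ⟨0, fun W _ T hT hW V _ G c S hS hcov R hR => ?_⟩
    have hsub : Subsingleton W := (Nat.card_eq_one_iff_unique.1 hW).1
    have hne : R.Nonempty := by
      by_contra hR'
      rw [Finset.not_nonempty_iff_eq_empty] at hR'
      subst hR'
      exact hR ⟨fun _ => 0, by simp, by simp⟩
    obtain ⟨v, hv⟩ := hne
    refine ⟨⟨fun _ => v, fun a b _ => Subsingleton.elim a b⟩, fun _ => hv,
      fun a b hab => absurd (Subsingleton.elim a b) hab.ne, fun e he => ?_⟩
    induction e with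
    | _ a b => exact absurd (Subsingleton.elim a b) (T.ne_of_adj he)
  | succ m ih =>
    obtain ⟨N, ih⟩ := ih
    set d := (m + 1) * (m + 1) with hd
    refine ⟨N + (2 * (d * h) + 1), fun W _ T hT hW V _ G c S hS hcov R hR => ?_⟩
    cases nonempty_fintype W
    cases nonempty_fintype V
    have hnt : Nontrivial W := by
      rw [← Finite.one_lt_card_iff_nontrivial]; omega
    -- remove a leaf `x` with neighbour `y`
    obtain ⟨x, hx⟩ := hT.exists_vert_degree_one_of_nontrivial
    have hT' : (T.induce {x}ᶜ).IsTree :=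
      ⟨hT.connected.induce_compl_singleton_of_degree_eq_one hx, hT.isAcyclic.induce _⟩
    obtain ⟨y, hxy, hy⟩ : ∃ y, T.Adj x y ∧ ∀ z, T.Adj x z → z = y := by
      obtain ⟨y, hy⟩ := Finset.card_eq_one.1 hx
      refine ⟨y, ?_, fun z hz => ?_⟩
      · rw [← mem_neighborFinset, hy]; simp
      · rw [← mem_neighborFinset, hy] at hz; simpa using hz
    have hcard : Nat.card ({x}ᶜ : Set W) = m + 1 := by
      rw [Nat.card_coe_set_eq, Set.ncard_compl, Set.ncard_singleton]; omega
    set L := R.filter fun v => ((R.filter (G.Adj v)).image fun w => c s(v, w)).card ≤ d with hL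
    set R' := R.filter fun v => ¬ ((R.filter (G.Adj v)).image fun w => c s(v, w)).card ≤ d with hR'
    have hR'N : ¬ ColorableOn G R' N := by
      intro h'
      have := h'.union (colorableOn_few_colors c S hS hcov R d)
      rw [hR', Finset.union_comm, Finset.filter_union_filter_not_eq] at this
      exact hR this
    obtain ⟨f, hfR, hfG, hfc⟩ := ih _ _ hT' hcard G c S hS hcov R' hR'N
    have hyx : y ∈ ({x}ᶜ : Set W) := hxy.ne'
    set u := f ⟨y, hyx⟩ with hu
    have huR := hfR ⟨y, hyx⟩
    rw [hR', Finset.mem_filter, not_le] at huR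
    -- the colours of the pairs of vertices of the smaller copy
    set B : Finset ℕ := Finset.univ.image fun ab : ({x}ᶜ : Set W) × ({x}ᶜ : Set W) =>
      c s(f ab.1, f ab.2) with hB
    have hBcard : B.card ≤ d := by
      refine Finset.card_image_le.trans ?_
      rw [Finset.card_univ, Fintype.card_prod, ← Nat.card_eq_fintype_card, hcard]
    obtain ⟨k, hk, hkB⟩ := Finset.exists_mem_notMem_of_card_lt_card (hBcard.trans_lt huR.2)
    obtain ⟨w, hw, rfl⟩ := Finset.mem_image.1 hk
    rw [Finset.mem_filter] at hw
    have hBmem (a b : ({x}ᶜ : Set W)) : c s(f a, f b) ∈ B :=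
      Finset.mem_image.2 ⟨(a, b), Finset.mem_univ _, rfl⟩
    have hwf (a : ({x}ᶜ : Set W)) : f a ≠ w := by
      rintro rfl
      exact hkB (hBmem ⟨y, hyx⟩ a)
    set g : W → V := fun a => if ha : a = x then w else f ⟨a, ha⟩ with hg
    have hgx : g x = w := by simp [hg]
    have hgf (a : W) (ha : a ≠ x) : g a = f ⟨a, ha⟩ := by simp [hg, ha]
    have hginj : Function.Injective g := by
      intro a b hab
      by_cases h1 : a = x <;> by_cases h2 : b = x
      · rw [h1, h2]
      · subst h1; rw [hgx, hgf b h2] at hab; exact absurd hab.symm (hwf _)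
      · subst h2; rw [hgx, hgf a h1] at hab; exact absurd hab (hwf _)
      · rw [hgf a h1, hgf b h2] at hab
        exact congrArg Subtype.val (f.injective hab)
    -- an edge of `T` is the pendant edge or an edge of the smaller tree
    have hedge (e : Sym2 W) (he : e ∈ T.edgeSet) : (e = s(x, y)) ∨
        ∃ e' ∈ (T.induce {x}ᶜ).edgeSet, e = e'.map Subtype.val := by
      induction e with
      | _ a b =>
        by_cases h1 : a = x
        · subst h1; left; rw [hy b he]
        by_cases h2 : b = x
        · subst h2; left; rw [hy a (show T.Adj a b from he).symm, Sym2.eq_swap]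
        exact Or.inr ⟨s(⟨a, h1⟩, ⟨b, h2⟩), he, rfl⟩
    have hmap (e' : Sym2 ({x}ᶜ : Set W)) : (e'.map Subtype.val).map g = e'.map f := by
      rw [Sym2.map_map]
      congr 1
      funext a
      exact hgf a a.2
    have hmapB (e' : Sym2 ({x}ᶜ : Set W)) : c (e'.map f) ∈ B := by
      induction e' with
      | _ a b => exact hBmem a b
    have hpend : (s(x, y)).map g = s(u, w) := by
      rw [Sym2.map_mk, hgx, hgf y hyx, Sym2.eq_swap]
    refine ⟨⟨g, hginj⟩, fun a => ?_, fun a b hab => ?_, fun e he e' he' hc => ?_⟩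
    · by_cases h1 : a = x
      · subst h1; rw [Function.Embedding.coeFn_mk, hgx]; exact hw.1
      · have := hfR ⟨a, h1⟩
        simp only [Function.Embedding.coeFn_mk, hgf a h1]
        exact (Finset.mem_filter.1 this).1
    · simp only [Function.Embedding.coeFn_mk]
      by_cases h1 : a = x
      · subst h1
        rw [hgx, hy b hab, hgf y hyx]; exact hw.2.symm
      by_cases h2 : b = x
      · subst h2
        rw [hgx, hy a hab.symm, hgf y hyx]; exact hw.2
      rw [hgf a h1, hgf b h2]
      exact hfG ⟨a, h1⟩ ⟨b, h2⟩ hab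
    · simp only [Function.Embedding.coeFn_mk] at hc
      rcases hedge e he with rfl | ⟨e₁, he₁, rfl⟩ <;> rcases hedge e' he' with rfl | ⟨e₂, he₂, rfl⟩
      · rfl
      · rw [hpend, hmap] at hc
        exact absurd (hc ▸ hmapB e₂) hkB
      · rw [hpend, hmap] at hc
        exact absurd (hc ▸ hmapB e₁) hkB
      · rw [hmap, hmap] at hc
        rw [hfc e₁ he₁ e₂ he₂ hc]

end RainbowTree

section MatchingCover

/-- Either `G` contains the matching `H`, or few vertices meet all edges of `G`. -/
lemma isContained_or_exists_cover {W V : Type*} [Finite W] [Finite V] (hWV : Nat.card W ≤ Nat.card V)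
    (G : SimpleGraph V) (H : SimpleGraph W) (hH : IsMatching H) :
    H ⊑ G ∨ ∃ S : Finset V, S.card ≤ Nat.card W ∧ ∀ u v, G.Adj u v → u ∈ S ∨ v ∈ S := by
  classical
  cases nonempty_fintype W
  cases nonempty_fintype V
  induction hm : H.edgeSet.ncard generalizing H with
  | zero =>
    left
    have h0 : H = ⊥ := by
      rw [Set.ncard_eq_zero (Set.toFinite _)] at hm
      exact edgeSet_eq_empty.1 hm
    rw [h0, bot_isContained_iff_card_le]
    simpa using hWV
  | succ m ih =>
    obtain ⟨e, he⟩ : H.edgeSet.Nonempty := by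
      rw [← Set.ncard_pos (Set.toFinite _)]; omega
    induction e with
    | _ a b =>
      have hab : H.Adj a b := he
      set H' := H.deleteEdges {s(a, b)} with hH'
      have hadj (x y : W) : H'.Adj x y ↔ H.Adj x y ∧ s(x, y) ≠ s(a, b) := by simp [hH']
      have hle : H' ≤ H := deleteEdges_le _
      have hm' : H'.edgeSet.ncard = m := by
        rw [hH', edgeSet_deleteEdges]
        have := Set.ncard_sdiff_singleton_add_one he (Set.toFinite _)
        omega
      rcases ih H' (fun u v w h1 h2 => hH u v w (hle h1) (hle h2)) hm' with hf | h
      swap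
      · exact Or.inr h
      obtain ⟨f⟩ := hf
      by_cases hcov : ∀ u v, G.Adj u v → u ∈ Finset.univ.image f ∨ v ∈ Finset.univ.image f
      · right
        refine ⟨Finset.univ.image f, Finset.card_image_le.trans ?_, hcov⟩
        simp
      · left
        push Not at hcov
        obtain ⟨x, y, hxy, hx, hy⟩ := hcov
        have hx' (w : W) : f w ≠ x := fun h => hx (h ▸ Finset.mem_image_of_mem _ (Finset.mem_univ w))
        have hy' (w : W) : f w ≠ y := fun h => hy (h ▸ Finset.mem_image_of_mem _ (Finset.mem_univ w))
        -- the isolated edge `ab` is moved to `xy`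
        set g : W → V := fun w => if w = a then x else if w = b then y else f w with hg
        have hga : g a = x := by simp [hg]
        have hgb : g b = y := by simp [hg, hab.ne']
        have hgf (w : W) (h1 : w ≠ a) (h2 : w ≠ b) : g w = f w := by simp [hg, h1, h2]
        refine ⟨copyOfInjective g ?_ ?_⟩
        · intro u v huv
          have hf (u v : W) (h : f u = f v) : u = v := f.injective h
          have hne := hxy.ne
          simp only [hg] at huv
          clear ih
          split_ifs at huv <;> grind only
        · intro u v huv
          by_cases h1 : u = a
          · subst h1
            rw [hH _ _ _ huv hab, hga, hgb]; exact hxy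
          by_cases h2 : u = b
          · subst h2
            rw [hH _ _ _ huv hab.symm, hga, hgb]; exact hxy.symm
          have h3 : v ≠ a := by
            rintro rfl
            exact h2 (hH _ _ _ huv.symm hab)
          have h4 : v ≠ b := by
            rintro rfl
            exact h1 (hH _ _ _ huv.symm hab.symm)
          rw [hgf u h1 h2, hgf v h3 h4]
          refine f.toHom.map_adj ((hadj u v).2 ⟨huv, ?_⟩)
          rw [Ne, Sym2.eq_iff]
          tauto

end MatchingCover

/-! ### Colourings of forests -/

section ArrowsBasic

variable {V W W₁ W₂ : Type*}

/-- Extension of an edge labelling to all pairs of vertices, by `0`. -/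
noncomputable def extendLabeling {G : SimpleGraph V} (χ : G.EdgeLabeling ℕ) (e : Sym2 V) : ℕ :=
  open Classical in if h : e ∈ G.edgeSet then χ ⟨e, h⟩ else 0

lemma extendLabeling_coe {G : SimpleGraph V} (χ : G.EdgeLabeling ℕ) (e : G.edgeSet) :
    extendLabeling χ e = χ e := by
  simp [extendLabeling]

lemma apply_mapEdgeSet {H : SimpleGraph W} {G : SimpleGraph V} (χ : G.EdgeLabeling ℕ)
    (f : Copy H G) (e : H.edgeSet) :
    χ (f.mapEdgeSet e) = extendLabeling χ ((e : Sym2 W).map f) :=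
  (extendLabeling_coe χ (f.mapEdgeSet e)).symm

lemma isMonochromatic_iff {H : SimpleGraph W} {G : SimpleGraph V} (χ : G.EdgeLabeling ℕ)
    (f : Copy H G) :
    IsMonochromatic χ f ↔ ∃ c, ∀ e ∈ H.edgeSet, extendLabeling χ (e.map f) = c := by
  simp only [IsMonochromatic, apply_mapEdgeSet, Subtype.forall]

lemma isRainbow_iff {H : SimpleGraph W} {G : SimpleGraph V} (χ : G.EdgeLabeling ℕ)
    (f : Copy H G) :
    IsRainbow χ f ↔ ∀ e ∈ H.edgeSet, ∀ e' ∈ H.edgeSet,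
      extendLabeling χ (e.map f) = extendLabeling χ (e'.map f) → e = e' := by
  simp only [IsRainbow, apply_mapEdgeSet, Subtype.forall, Subtype.mk.injEq]

lemma exists_embedding_eqOn [Finite W] [Finite V] (hWV : Nat.card W ≤ Nat.card V) (A : Set W)
    (f : W → V) (hf : Set.InjOn f A) : ∃ g : W ↪ V, Set.EqOn g f A := by
  classical
  cases nonempty_fintype W
  cases nonempty_fintype V
  have hcard : Nat.card (Aᶜ : Set W) ≤ Nat.card ((f '' A)ᶜ : Set V) := by
    rw [Nat.card_coe_set_eq, Nat.card_coe_set_eq, Set.ncard_compl, Set.ncard_compl,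
      hf.ncard_image]
    omega
  rw [Nat.card_eq_fintype_card, Nat.card_eq_fintype_card] at hcard
  obtain ⟨h⟩ := Function.Embedding.nonempty_of_card_le hcard
  refine ⟨⟨fun w => if hw : w ∈ A then f w else h ⟨w, hw⟩, fun a b hab => ?_⟩, fun a ha => ?_⟩
  · have hA (x : W) (y : (Aᶜ : Set W)) (hx : x ∈ A) : f x ≠ h y := fun h' =>
      (h y).2 ⟨x, hx, h'⟩
    by_cases ha : a ∈ A <;> by_cases hb : b ∈ A <;>
      simp only [ha, hb, dif_pos, dif_neg, not_false_eq_true] at hab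
    · exact hf ha hb hab
    · exact absurd hab (hA _ _ ha)
    · exact absurd hab.symm (hA _ _ hb)
    · exact congrArg Subtype.val (h.injective (Subtype.ext hab))
  · exact dif_pos ha

/-- In a constant colouring there is no rainbow copy of a graph with two edges. -/
lemma isContained_of_arrows {G : SimpleGraph V} {H₁ : SimpleGraph W₁} {H₂ : SimpleGraph W₂}
    (he₂ : 2 ≤ H₂.edgeSet.ncard) (h : Arrows G H₁ H₂) : H₁ ⊑ G := by
  rcases h (fun _ => (0 : ℕ)) with ⟨f, -⟩ | ⟨f, hf⟩
  · exact ⟨f⟩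
  · exfalso
    obtain ⟨e, he, e', he', hne⟩ := (Set.one_lt_ncard_iff_nontrivial_and_finite.1 he₂).1
    exact hne (congrArg Subtype.val (hf ⟨e, he⟩ ⟨e', he'⟩ rfl))

/-- A graph of large chromatic number arrows (matching, forest): a colouring without monochromatic
copy of the matching has colour classes with small covers. -/
lemma exists_arrows_of_not_colorable [Finite W₁] [Finite W₂] [Nonempty W₂] (H₁ : SimpleGraph W₁)
    (H₂ : SimpleGraph W₂) (hH₁ : IsMatching H₁) (hH₂ : H₂.IsAcyclic) :
    ∃ N : ℕ, ∀ {V : Type*} [Finite V] (G : SimpleGraph V), Nat.card W₁ ≤ Nat.card V →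
      ¬ G.Colorable N → Arrows G H₁ H₂ := by
  classical
  obtain ⟨T, hT, -, hTtree⟩ := (connected_top (V := W₂)).exists_isTree_le_of_le_of_isAcyclic
    (le_top : H₂ ≤ ⊤) hH₂
  obtain ⟨m, hm⟩ : ∃ m, Nat.card W₂ = m + 1 := ⟨Nat.card W₂ - 1, by
    have : 0 < Nat.card W₂ := Nat.card_pos
    omega⟩
  obtain ⟨N, hN⟩ := exists_rainbow_tree (Nat.card W₁) m
  refine ⟨N, fun {V} _ G hV hG χ => ?_⟩
  cases nonempty_fintype V
  by_contra! hχ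
  obtain ⟨hmono, hrain⟩ := hχ
  have hcov (k : ℕ) : ∃ S : Finset V, S.card ≤ Nat.card W₁ ∧
      ∀ u v, (χ.labelGraph k).Adj u v → u ∈ S ∨ v ∈ S := by
    refine (isContained_or_exists_cover hV (χ.labelGraph k) H₁ hH₁).resolve_left ?_
    rintro ⟨f⟩
    refine hmono ((Copy.ofLE _ _ (EdgeLabeling.labelGraph_le χ)).comp f)
      ((isMonochromatic_iff _ _).2 ⟨k, fun e he => ?_⟩)
    induction e with
    | _ a b =>
      have hab := f.toHom.map_adj (show H₁.Adj a b from he)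
      rw [EdgeLabeling.labelGraph_adj] at hab
      obtain ⟨h1, h2⟩ := hab
      exact (extendLabeling_coe χ ⟨_, h1⟩).trans h2
  choose S hS hS' using hcov
  obtain ⟨f, -, hfG, hf⟩ := hN W₂ T hTtree hm G (extendLabeling χ) S hS
    (fun u v huv => hS' _ u v (by
      rw [EdgeLabeling.labelGraph_adj]
      exact ⟨huv, (extendLabeling_coe χ ⟨_, huv⟩).symm⟩)) Finset.univ
    (fun h => hG h.colorable)
  refine hrain (copyOfInjective f f.injective fun a b hab => hfG a b (hT hab))
    ((isRainbow_iff _ _).2 fun e he e' he' h => hf e ?_ e' ?_ h)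
  · exact edgeSet_mono hT he
  · exact edgeSet_mono hT he'

end ArrowsBasic

section Forests

variable {V W W₁ W₂ : Type*}

/-- Let every edge `e` of `G` be coloured by one of its endpoints `φ e`. Then there is no
monochromatic matching of size two, so if `G` arrows then there is a copy of `H₂` on which `φ` is
injective. -/
lemma exists_copy_injOn_of_arrows [Finite V] {G : SimpleGraph V} {H₁ : SimpleGraph W₁}
    {H₂ : SimpleGraph W₂} (hH₁ : IsMatching H₁) (he₁ : 2 ≤ H₁.edgeSet.ncard)
    (h : Arrows G H₁ H₂) (φ : Sym2 V → V) (hφ : ∀ e ∈ G.edgeSet, φ e ∈ e) :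
    ∃ f : Copy H₂ G, ∀ e ∈ H₂.edgeSet, ∀ e' ∈ H₂.edgeSet, φ (e.map f) = φ (e'.map f) → e = e' := by
  obtain ⟨enc, henc⟩ := exists_injective_nat V
  rcases h (fun e => enc (φ e)) with ⟨f, c, hf⟩ | ⟨f, hf⟩
  · exfalso
    obtain ⟨e, he, e', he', hne⟩ := (Set.one_lt_ncard_iff_nontrivial_and_finite.1 he₁).1
    have heq : φ (e.map f) = φ (e'.map f) := henc ((hf ⟨e, he⟩).trans (hf ⟨e', he'⟩).symm)
    have h1 := hφ _ (f.mapEdgeSet ⟨e, he⟩).2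
    have h2 := hφ _ (f.mapEdgeSet ⟨e', he'⟩).2
    change φ (e.map f) ∈ e.map f at h1
    change φ (e'.map f) ∈ e'.map f at h2
    rw [← heq] at h2
    obtain ⟨x, hx, hx'⟩ := Sym2.mem_map.1 h1
    obtain ⟨y, hy, hy'⟩ := Sym2.mem_map.1 h2
    have hxy : x = y := f.injective (hx'.trans hy'.symm)
    subst hxy
    obtain ⟨a, rfl⟩ := Sym2.mem_iff_exists.1 hx
    obtain ⟨b, rfl⟩ := Sym2.mem_iff_exists.1 hy
    exact hne (by rw [hH₁ x a b he he'])
  · refine ⟨f, fun e he e' he' heq => ?_⟩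
    exact congrArg Subtype.val (hf ⟨e, he⟩ ⟨e', he'⟩ (congrArg enc heq))

/-- In a forest, the neighbour of `v` which is closer than `v` to a given root is unique. -/
lemma eq_of_adj_of_dist_lt {G : SimpleGraph V} (hG : G.IsAcyclic) {r v a b : V}
    (hr : G.Reachable r v) (ha : G.Adj v a) (hb : G.Adj v b) (had : G.dist r a < G.dist r v)
    (hbd : G.dist r b < G.dist r v) : a = b := by
  obtain ⟨p, hp, hpl⟩ := hr.exists_path_of_dist
  have key (x : V) (hx : G.Adj v x) (hxd : G.dist r x < G.dist r v) : x = p.penultimate := by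
    refine hG.eq_penultimate_of_adj_end hp hx ?_
    by_contra hxp
    obtain ⟨q, hq, hql⟩ := (hr.trans hx.reachable).exists_path_of_dist
    have hv : v ∈ q.support := hG.mem_support_of_ne_mem_support_of_adj_of_isPath hq hp hx.symm hxp
    rw [hG.path_concat hp hq hx hv, Walk.length_concat] at hql
    omega
  rw [key a ha had, key b hb hbd]

/-- Colouring each edge of a forest by its endpoint in one of the two bipartition classes, every
walk `a b c d` has two consecutive edges of the same colour; colouring each edge by its endpoint
closer to the root of its component, each vertex sees at most two colours. -/
lemma not_arrows_of_isAcyclic [Finite V] {G : SimpleGraph V} (hG : G.IsAcyclic)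
    {H₁ : SimpleGraph W₁} {H₂ : SimpleGraph W₂} (hH₁ : IsMatching H₁)
    (he₁ : 2 ≤ H₁.edgeSet.ncard)
    (hH₂ : (∃ a b c d, H₂.Adj a b ∧ H₂.Adj b c ∧ H₂.Adj c d ∧ a ≠ c ∧ b ≠ d) ∨
      ∃ v x y z, H₂.Adj v x ∧ H₂.Adj v y ∧ H₂.Adj v z ∧ x ≠ y ∧ x ≠ z ∧ y ≠ z) :
    ¬ Arrows G H₁ H₂ := by
  classical
  intro h
  rcases hH₂ with ⟨a, b, c, d, hab, hbc, hcd, hac, hbd⟩ | ⟨v, x, y, z, hvx, hvy, hvz, hxy, hxz, hyz⟩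
  · obtain ⟨C⟩ := hG.colorable_two
    have hex (e : Sym2 V) : ∃ v ∈ e, e ∈ G.edgeSet → C v = 0 := by
      induction e with
      | _ u v =>
        by_cases he : G.Adj u v
        · have := C.valid he
          by_cases hu : C u = 0
          · exact ⟨u, Sym2.mem_mk_left _ _, fun _ => hu⟩
          · exact ⟨v, Sym2.mem_mk_right _ _, fun _ => by omega⟩
        · exact ⟨u, Sym2.mem_mk_left _ _, fun h => absurd h he⟩
    choose φ hφ hφ' using hex
    have key (u v : V) (huv : G.Adj u v) (hu : C u = 0) : φ s(u, v) = u := by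
      rcases Sym2.mem_iff.1 (hφ s(u, v)) with h | h
      · exact h
      · have := hφ' s(u, v) huv
        rw [h] at this
        exact absurd (hu.trans this.symm) (C.valid huv)
    obtain ⟨f, hf⟩ := exists_copy_injOn_of_arrows hH₁ he₁ h φ fun e _ => hφ e
    have hab' := f.toHom.map_adj hab
    have hbc' := f.toHom.map_adj hbc
    have hcd' := f.toHom.map_adj hcd
    by_cases hb : C (f b) = 0
    · have := hf s(b, a) hab.symm s(b, c) hbc
        ((key _ _ hab'.symm hb).trans (key _ _ hbc' hb).symm)
      exact hac (Sym2.congr_right.1 this)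
    · have hc : C (f c) = 0 := by
        have : C (f b) ≠ C (f c) := C.valid hbc'
        omega
      have := hf s(c, b) hbc.symm s(c, d) hcd
        ((key _ _ hbc'.symm hc).trans (key _ _ hcd' hc).symm)
      exact hbd (Sym2.congr_right.1 this)
  · -- `ρ v` is the distance to the root of the component
    set r : V → V := fun v => (G.connectedComponentMk v).out with hr
    have hreach (v : V) : G.Reachable (r v) v :=
      ConnectedComponent.exact (Quot.out_eq (G.connectedComponentMk v))
    have hradj {u v : V} (huv : G.Adj u v) : r u = r v := by
      simp only [hr, ConnectedComponent.sound huv.reachable]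
    set ρ : V → ℕ := fun v => G.dist (r v) v with hρ
    have hex (e : Sym2 V) : ∃ v ∈ e, ∀ w ∈ e, ρ v ≤ ρ w := by
      induction e with
      | _ u v =>
        rcases le_total (ρ u) (ρ v) with h | h
        · exact ⟨u, Sym2.mem_mk_left _ _, by simpa using h⟩
        · exact ⟨v, Sym2.mem_mk_right _ _, by simpa using h⟩
    choose φ hφ hφ' using hex
    obtain ⟨f, hf⟩ := exists_copy_injOn_of_arrows hH₁ he₁ h φ fun e _ => hφ e
    have hne {u v : V} (huv : G.Adj u v) : ρ u ≠ ρ v := by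
      simp only [hρ, ← hradj huv]
      exact hG.dist_ne_of_adj huv (hreach u)
    have hlt {x : W₂} (hvx : H₂.Adj v x) (hx : φ s(f v, f x) ≠ f v) : ρ (f x) < ρ (f v) := by
      have h1 := (Sym2.mem_iff.1 (hφ s(f v, f x))).resolve_left hx
      have h2 := hφ' s(f v, f x) (f v) (Sym2.mem_mk_left _ _)
      rw [h1] at h2
      exact lt_of_le_of_ne h2 (hne (f.toHom.map_adj hvx)).symm
    have huniq {x y : W₂} (hvx : H₂.Adj v x) (hvy : H₂.Adj v y) (hx : φ s(f v, f x) ≠ f v)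
        (hy : φ s(f v, f y) ≠ f v) : x = y := by
      have h1 := hlt hvx hx
      have h2 := hlt hvy hy
      have hx' : G.Adj (f v) (f x) := f.toHom.map_adj hvx
      have hy' : G.Adj (f v) (f y) := f.toHom.map_adj hvy
      simp only [hρ, ← hradj hx'] at h1
      simp only [hρ, ← hradj hy'] at h2
      exact f.injective (eq_of_adj_of_dist_lt hG (hreach _) hx' hy' h1 h2)
    have hsame {x y : W₂} (hvx : H₂.Adj v x) (hvy : H₂.Adj v y) (hx : φ s(f v, f x) = f v)
        (hy : φ s(f v, f y) = f v) : x = y := by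
      have := hf s(v, x) hvx s(v, y) hvy (hx.trans hy.symm)
      exact Sym2.congr_right.1 this
    by_cases h1 : φ s(f v, f x) = f v <;> by_cases h2 : φ s(f v, f y) = f v
    · exact hxy (hsame hvx hvy h1 h2)
    · by_cases h3 : φ s(f v, f z) = f v
      · exact hxz (hsame hvx hvz h1 h3)
      · exact hyz (huniq hvy hvz h2 h3)
    · by_cases h3 : φ s(f v, f z) = f v
      · exact hyz (hsame hvy hvz h2 h3)
      · exact hxz (huniq hvx hvz h1 h3)
    · exact hxy (huniq hvx hvy h1 h2)

/-- A graph that is not a short forest has a walk with three edges that never turns back, or a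
vertex of degree at least three. -/
lemma exists_of_not_isShortForest {H : SimpleGraph W} (hH : ¬ IsShortForest H) :
    (∃ a b c d, H.Adj a b ∧ H.Adj b c ∧ H.Adj c d ∧ a ≠ c ∧ b ≠ d) ∨
      ∃ v x y z, H.Adj v x ∧ H.Adj v y ∧ H.Adj v z ∧ x ≠ y ∧ x ≠ z ∧ y ≠ z := by
  classical
  by_contra! hcon
  obtain ⟨hpath, hdeg⟩ := hcon
  apply hH
  intro C
  by_cases hsub : C.supp.Subsingleton
  · exact Or.inl hsub
  right
  rw [Set.not_subsingleton_iff] at hsub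
  obtain ⟨u, hu, v', hv', hne⟩ := hsub
  have hreach : ∀ x y, x ∈ C.supp → y ∈ C.supp → H.Reachable x y := fun x y hx hy =>
    ConnectedComponent.exact (hx.trans hy.symm)
  have hadjC {x y : W} (hx : x ∈ C.supp) (hxy : H.Adj x y) : y ∈ C.supp :=
    (ConnectedComponent.sound hxy.reachable).symm.trans hx
  have hsupp (S : Set W) {x : W} (hxC : x ∈ C.supp) (hx : x ∈ S)
      (hS : ∀ a ∈ S, ∀ b, H.Adj a b → b ∈ S) : C.supp ⊆ S := by
    intro y hy
    obtain ⟨p⟩ := hreach x y hxC hy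
    clear hy hxC
    induction p with
    | nil => exact hx
    | cons h _ ih => exact ih (hS _ hx _ h)
  obtain ⟨v, huv⟩ : ∃ v, H.Adj u v := by
    obtain ⟨p⟩ := hreach u v' hu hv'
    cases p with
    | nil => exact absurd rfl hne
    | cons h _ => exact ⟨_, h⟩
  have hv := hadjC hu huv
  have hcherry {u v w : W} (hu : u ∈ C.supp) (huv : H.Adj u v) (huw : H.Adj u w) (hvw : v ≠ w) :
      Nonempty (H.induce C.supp ≃g cherry) := by
    have hv := hadjC hu huv
    have hw := hadjC hu huw
    have hnu (x : W) (hx : H.Adj u x) : x = v ∨ x = w := by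
      by_contra! h
      exact h.2 (hdeg u v w x huv huw hx hvw h.1.symm).symm
    have hnv (x : W) (hx : H.Adj v x) : x = u := by
      by_contra h
      exact h (hpath w u v x huw.symm huv hx hvw.symm).symm
    have hnw (x : W) (hx : H.Adj w x) : x = u := by
      by_contra h
      exact h (hpath v u w x huv.symm huw hx hvw).symm
    have hC : C.supp ⊆ {u, v, w} := by
      refine hsupp _ hu (by simp) fun a ha b hab => ?_
      rcases ha with rfl | rfl | rfl
      · rcases hnu b hab with rfl | rfl <;> simp
      · simp [hnv b hab]
      · simp [hnw b hab]
    let f : Fin 1 ⊕ Fin 2 → C.supp := Sum.elim (fun _ => ⟨u, hu⟩) ![⟨v, hv⟩, ⟨w, hw⟩]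
    have hf : Function.Bijective f := by
      constructor
      · rintro (i | i) (j | j) hij
        · rw [Subsingleton.elim i j]
        · fin_cases j
          · exact absurd (congrArg Subtype.val hij) huv.ne
          · exact absurd (congrArg Subtype.val hij) huw.ne
        · fin_cases i
          · exact absurd (congrArg Subtype.val hij) huv.ne'
          · exact absurd (congrArg Subtype.val hij) huw.ne'
        · fin_cases i <;> fin_cases j
          · rfl
          · exact absurd (congrArg Subtype.val hij) hvw
          · exact absurd (congrArg Subtype.val hij) hvw.symm
          · rfl
      · rintro ⟨x, hx⟩
        rcases hC hx with rfl | rfl | rfl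
        · exact ⟨Sum.inl 0, rfl⟩
        · exact ⟨Sum.inr 0, rfl⟩
        · exact ⟨Sum.inr 1, rfl⟩
    have hvw' : ¬ H.Adj v w := fun h => huw.ne (hnv w h).symm
    refine ⟨(⟨Equiv.ofBijective f hf, ?_⟩ : cherry ≃g H.induce C.supp).symm⟩
    rintro (i | i) (j | j)
    · simp [f]
    · fin_cases j
      · simpa [f] using huv
      · simpa [f] using huw
    · fin_cases i
      · simpa [f] using huv.symm
      · simpa [f] using huw.symm
    · fin_cases i <;> fin_cases j <;> simp [f, hvw', H.adj_comm w v]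
  by_cases hnu : ∃ w, H.Adj u w ∧ v ≠ w
  · obtain ⟨w, huw, hvw⟩ := hnu
    exact Or.inr (hcherry hu huv huw hvw)
  by_cases hnv : ∃ w, H.Adj v w ∧ u ≠ w
  · obtain ⟨w, hvw, huw⟩ := hnv
    exact Or.inr (hcherry hv huv.symm hvw huw)
  left
  push Not at hnu hnv
  have hC : C.supp ⊆ {u, v} := by
    refine hsupp _ hu (by simp) fun a ha b hab => ?_
    rcases ha with rfl | rfl
    · simp [← hnu b hab]
    · simp [← hnv b hab]
  let f : Fin 2 → C.supp := ![⟨u, hu⟩, ⟨v, hv⟩]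
  have hf : Function.Bijective f := by
    constructor
    · intro i j hij
      fin_cases i <;> fin_cases j
      · rfl
      · exact absurd (congrArg Subtype.val hij) huv.ne
      · exact absurd (congrArg Subtype.val hij) huv.ne'
      · rfl
    · rintro ⟨x, hx⟩
      rcases hC hx with rfl | rfl
      · exact ⟨0, rfl⟩
      · exact ⟨1, rfl⟩
  refine ⟨(⟨Equiv.ofBijective f hf, ?_⟩ : (⊤ : SimpleGraph (Fin 2)) ≃g H.induce C.supp).symm⟩
  intro i j
  fin_cases i <;> fin_cases j <;> simp [f, huv, huv.symm]

end Forests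

/-! ### Cherries and matchings with two edges -/

section Cherries

variable {V W W₁ W₂ : Type*}

lemma IsCherry.exists_adj_iff {H : SimpleGraph W} (hH : IsCherry H) :
    ∃ z x y, x ≠ y ∧ H.Adj z x ∧ H.Adj z y ∧ ∀ e ∈ H.edgeSet, e = s(z, x) ∨ e = s(z, y) := by
  obtain ⟨φ⟩ := hH
  set ψ := φ.symm with hψ
  have hadj (a b) : H.Adj (ψ a : W) (ψ b : W) ↔ cherry.Adj a b := by
    rw [← ψ.map_adj_iff]; rfl
  refine ⟨ψ (Sum.inl 0), ψ (Sum.inr 0), ψ (Sum.inr 1), fun h => ?_, (hadj _ _).2 (by simp),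
    (hadj _ _).2 (by simp), fun e he => ?_⟩
  · have := ψ.injective (Subtype.ext h)
    simp at this
  · induction e with
    | _ a b =>
      have hab : H.Adj a b := he
      obtain ⟨a', ha'⟩ := ψ.surjective ⟨a, ⟨b, hab⟩⟩
      obtain ⟨b', hb'⟩ := ψ.surjective ⟨b, ⟨a, hab.symm⟩⟩
      obtain rfl : a = (ψ a' : W) := by rw [ha']
      obtain rfl : b = (ψ b' : W) := by rw [hb']
      rw [hadj] at hab
      have h0 (i : Fin 1) : i = 0 := Subsingleton.elim _ _
      rcases a' with i | i <;> rcases b' with j | j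
      · simp at hab
      · rw [h0 i]; fin_cases j <;> simp
      · rw [h0 j]; fin_cases i <;> simp
      · simp at hab

/-- Without a rainbow cherry, adjacent edges have the same colour. -/
lemma IsCherry.color_eq [Finite V] [Finite W₂] {G : SimpleGraph V} {H₂ : SimpleGraph W₂}
    (hH₂ : IsCherry H₂) (hV : Nat.card W₂ ≤ Nat.card V) {χ : G.EdgeLabeling ℕ}
    (hχ : ¬ ∃ f : Copy H₂ G, IsRainbow χ f) {a b c : V} (hba : G.Adj b a) (hbc : G.Adj b c) :
    extendLabeling χ s(b, a) = extendLabeling χ s(b, c) := by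
  classical
  by_contra hne
  have hac : a ≠ c := by rintro rfl; exact hne rfl
  obtain ⟨z, x, y, hxy, hzx, hzy, hedge⟩ := hH₂.exists_adj_iff
  set f : W₂ → V := fun w => if w = z then b else if w = x then a else c with hf
  have hfz : f z = b := by simp [hf]
  have hfx : f x = a := by simp [hf, hzx.ne']
  have hfy : f y = c := by simp [hf, hzy.ne', hxy.symm]
  obtain ⟨g, hg⟩ := exists_embedding_eqOn hV {z, x, y} f (by
    intro u hu v hv huv
    have := hba.ne
    have := hbc.ne
    rcases hu with rfl | rfl | rfl <;> rcases hv with rfl | rfl | rfl <;>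
      simp only [hfz, hfx, hfy] at huv <;> first | rfl | exact absurd huv (by tauto))
  have hgz : g z = b := (hg (by simp)).trans hfz
  have hgx : g x = a := (hg (by simp)).trans hfx
  have hgy : g y = c := (hg (by simp)).trans hfy
  refine hχ ⟨copyOfInjective g g.injective fun u v huv => ?_, (isRainbow_iff _ _).2 ?_⟩
  · have h1 : s(u, v).map g ∈ G.edgeSet := by
      rcases hedge s(u, v) huv with h | h <;> rw [h, Sym2.map_mk, hgz]
      · rw [hgx]; exact hba
      · rw [hgy]; exact hbc
    exact h1
  · intro e he e' he' heq
    change extendLabeling χ (e.map g) = extendLabeling χ (e'.map g) at heq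
    rcases hedge e he with rfl | rfl <;> rcases hedge e' he' with rfl | rfl
    · rfl
    · rw [Sym2.map_mk, Sym2.map_mk, hgz, hgx, hgy] at heq; exact absurd heq hne
    · rw [Sym2.map_mk, Sym2.map_mk, hgz, hgx, hgy] at heq; exact absurd heq.symm hne
    · rfl

lemma IsCherry.color_eq_of_reachable [Finite V] [Finite W₂] {G : SimpleGraph V}
    {H₂ : SimpleGraph W₂} (hH₂ : IsCherry H₂) (hV : Nat.card W₂ ≤ Nat.card V)
    {χ : G.EdgeLabeling ℕ} (hχ : ¬ ∃ f : Copy H₂ G, IsRainbow χ f) {a b x y : V}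
    (hab : G.Adj a b) (hxy : G.Adj x y) (hax : G.Reachable a x) :
    extendLabeling χ s(a, b) = extendLabeling χ s(x, y) := by
  obtain ⟨p⟩ := hax
  induction p generalizing b with
  | nil => exact hH₂.color_eq hV hχ hab hxy
  | cons h _ ih =>
    rw [hH₂.color_eq hV hχ hab h, Sym2.eq_swap]
    exact ih h.symm hxy

/-- If no cherry is rainbow, then a copy of `H₁` inside a single component is monochromatic. -/
lemma IsCherry.arrows [Finite V] [Finite W₂] {G : SimpleGraph V} {H₁ : SimpleGraph W₁}
    {H₂ : SimpleGraph W₂} (hH₂ : IsCherry H₂) (hV : Nat.card W₂ ≤ Nat.card V) (f : Copy H₁ G)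
    (hf : ∀ a ∈ H₁.support, ∀ b ∈ H₁.support, G.Reachable (f a) (f b)) : Arrows G H₁ H₂ := by
  intro χ
  by_contra! hχ
  obtain ⟨hmono, hrain⟩ := hχ
  refine hmono f ((isMonochromatic_iff _ _).2 ?_)
  by_cases h0 : H₁ = ⊥
  · exact ⟨0, by simp [h0]⟩
  obtain ⟨a, b, hab⟩ := ne_bot_iff_exists_adj.1 h0
  refine ⟨extendLabeling χ s(f a, f b), fun e he => ?_⟩
  induction e with
  | _ x y =>
    exact hH₂.color_eq_of_reachable hV (fun ⟨g, hg⟩ => hrain g hg) (f.toHom.map_adj he)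
      (f.toHom.map_adj hab) (hf x ⟨y, he⟩ a ⟨b, hab⟩)

/-- Colouring every component with its own colour shows that if `G` arrows `(H₁, cherry)`, then
all edges of some copy of `H₁` lie in one component. -/
lemma IsCherry.exists_copy_of_arrows [Finite V] {G : SimpleGraph V} {H₁ : SimpleGraph W₁}
    {H₂ : SimpleGraph W₂} (hH₂ : IsCherry H₂) (h : Arrows G H₁ H₂) :
    ∃ f : Copy H₁ G, ∀ a ∈ H₁.support, ∀ b ∈ H₁.support, G.Reachable (f a) (f b) := by
  obtain ⟨enc, henc⟩ := exists_injective_nat G.ConnectedComponent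
  set φ : Sym2 V → G.ConnectedComponent := fun e => G.connectedComponentMk e.out.1 with hφ
  have hφ' (u v : V) (huv : G.Adj u v) : φ s(u, v) = G.connectedComponentMk u := by
    rcases Sym2.mem_iff.1 (Sym2.out_fst_mem s(u, v)) with h | h
    · simp only [hφ, h]
    · simp only [hφ, h]
      exact ConnectedComponent.sound huv.symm.reachable
  rcases h (fun e => enc (φ e)) with ⟨f, c, hf⟩ | ⟨f, hf⟩
  · refine ⟨f, ?_⟩
    rintro a ⟨a', ha⟩ b ⟨b', hb⟩
    have := henc ((hf ⟨s(a, a'), ha⟩).trans (hf ⟨s(b, b'), hb⟩).symm)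
    change φ s(f a, f a') = φ s(f b, f b') at this
    rw [hφ' (f a) (f a') (f.toHom.map_adj ha), hφ' (f b) (f b') (f.toHom.map_adj hb)] at this
    exact ConnectedComponent.exact this
  · exfalso
    obtain ⟨z, x, y, hxy, hzx, hzy, -⟩ := hH₂.exists_adj_iff
    have heq : φ s(f z, f x) = φ s(f z, f y) := by
      rw [hφ' (f z) (f x) (f.toHom.map_adj hzx), hφ' (f z) (f y) (f.toHom.map_adj hzy)]
    have := hf ⟨s(z, x), hzx⟩ ⟨s(z, y), hzy⟩ (congrArg enc heq)
    exact hxy (Sym2.congr_right.1 (congrArg Subtype.val this))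

/-- A connected graph contains trees of all smaller orders. -/
lemma exists_isTree_isContained {k : ℕ} (hk : 1 ≤ k) (m : ℕ) : ∀ (W : Type*) [Finite W]
    (H : SimpleGraph W), H.Connected → Nat.card W = k + m →
    ∃ T : SimpleGraph (Fin k), T.IsTree ∧ T ⊑ H := by
  induction m with
  | zero =>
    intro W _ H hH hW
    obtain ⟨T, hT, hTtree⟩ := hH.exists_isTree_le
    obtain ⟨e⟩ : Nonempty (W ≃ Fin k) := ⟨Finite.equivFinOfCardEq hW⟩
    have hiso : T ≃g T.map e.toEmbedding := Iso.map e T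
    exact ⟨T.map e.toEmbedding, hiso.isTree_iff.1 hTtree,
      hiso.isContained'.trans (IsContained.of_le hT)⟩
  | succ m ih =>
    intro W _ H hH hW
    have : Nontrivial W := by rw [← Finite.one_lt_card_iff_nontrivial]; omega
    obtain ⟨v, hv⟩ := hH.exists_connected_induce_compl_singleton_of_finite_nontrivial
    obtain ⟨T, hT, hTH⟩ := ih _ _ hv (by
      rw [Nat.card_coe_set_eq, Set.ncard_compl, Set.ncard_singleton]; omega)
    exact ⟨T, hT, hTH.trans ⟨Copy.induce H _⟩⟩

lemma IsCherry.exists_isTree_of_arrows [Finite V] {G : SimpleGraph V} {H₁ : SimpleGraph W₁}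
    {H₂ : SimpleGraph W₂} (hH₂ : IsCherry H₂) {k : ℕ} (hk : 1 ≤ k) (hH₁ : H₁.support.ncard = k)
    (h : Arrows G H₁ H₂) : ∃ T : SimpleGraph (Fin k), T.IsTree ∧ T ⊑ G := by
  obtain ⟨f, hf⟩ := hH₂.exists_copy_of_arrows h
  obtain ⟨a, ha⟩ : H₁.support.Nonempty := by
    rw [← Set.ncard_pos (Set.finite_of_ncard_pos (by omega))]; omega
  set C := G.connectedComponentMk (f a) with hC
  have hsub : f '' H₁.support ⊆ C.supp := by
    rintro _ ⟨b, hb, rfl⟩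
    exact ConnectedComponent.sound (hf b hb a ha)
  have hcard : k ≤ Nat.card C.supp := by
    rw [Nat.card_coe_set_eq, ← hH₁, ← Set.ncard_image_of_injective _ f.injective]
    exact Set.ncard_le_ncard hsub (Set.toFinite _)
  obtain ⟨T, hT, hTC⟩ := exists_isTree_isContained hk (Nat.card C.supp - k) C.supp
    (G.induce C.supp) C.connected_toSimpleGraph (by omega)
  exact ⟨T, hT, hTC.trans ⟨Copy.induce G _⟩⟩

end Cherries

section TwoEdges

variable {V W₁ W₂ : Type*}

/-- Without a rainbow matching of size two, disjoint edges have the same colour. -/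
lemma IsTwoEdgeMatching.color_eq [Finite V] [Finite W₂] {G : SimpleGraph V} {H₂ : SimpleGraph W₂}
    (hH₂ : IsTwoEdgeMatching H₂) (hV : Nat.card W₂ ≤ Nat.card V) {χ : G.EdgeLabeling ℕ}
    (hχ : ¬ ∃ f : Copy H₂ G, IsRainbow χ f) {a b c d : V} (hab : G.Adj a b) (hcd : G.Adj c d)
    (hac : a ≠ c) (had : a ≠ d) (hbc : b ≠ c) (hbd : b ≠ d) :
    extendLabeling χ s(a, b) = extendLabeling χ s(c, d) := by
  classical
  by_contra hne
  obtain ⟨hmat, hcard⟩ := hH₂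
  obtain ⟨e₁, e₂, he, hedge⟩ := Set.ncard_eq_two.1 hcard
  induction e₁ with
  | _ x y =>
  induction e₂ with
  | _ z w =>
  have hxy : H₂.Adj x y := by rw [← mem_edgeSet, hedge]; simp
  have hzw : H₂.Adj z w := by rw [← mem_edgeSet, hedge]; simp
  have hxz : x ≠ z := by
    rintro rfl; exact he (by rw [hmat _ _ _ hxy hzw])
  have hxw : x ≠ w := by
    rintro rfl; exact he (by rw [hmat _ _ _ hxy hzw.symm, Sym2.eq_swap])
  have hyz : y ≠ z := by
    rintro rfl; exact he (by rw [hmat _ _ _ hxy.symm hzw, Sym2.eq_swap])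
  have hyw : y ≠ w := by
    rintro rfl; exact he (by rw [hmat _ _ _ hxy.symm hzw.symm])
  set f : W₂ → V := fun u => if u = x then a else if u = y then b else if u = z then c else d
    with hf
  have hfx : f x = a := by simp [hf]
  have hfy : f y = b := by simp [hf, hxy.ne']
  have hfz : f z = c := by simp [hf, hxz.symm, hyz.symm]
  have hfw : f w = d := by simp [hf, hxw.symm, hyw.symm, hzw.ne']
  obtain ⟨g, hg⟩ := exists_embedding_eqOn hV {x, y, z, w} f (by
    have := hab.ne
    have := hcd.ne
    intro u hu v hv huv
    rcases hu with rfl | rfl | rfl | rfl <;> rcases hv with rfl | rfl | rfl | rfl <;>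
      simp only [hfx, hfy, hfz, hfw] at huv <;> grind only)
  have hgx : g x = a := (hg (by simp)).trans hfx
  have hgy : g y = b := (hg (by simp)).trans hfy
  have hgz : g z = c := (hg (by simp)).trans hfz
  have hgw : g w = d := (hg (by simp)).trans hfw
  refine hχ ⟨copyOfInjective g g.injective fun u v huv => ?_, (isRainbow_iff _ _).2 ?_⟩
  · have h1 : s(u, v).map g ∈ G.edgeSet := by
      have h2 : s(u, v) ∈ H₂.edgeSet := huv
      rw [hedge] at h2
      rcases h2 with h | h <;> rw [h, Sym2.map_mk]
      · rw [hgx, hgy]; exact hab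
      · rw [hgz, hgw]; exact hcd
    exact h1
  · intro e he e' he' heq
    change extendLabeling χ (e.map g) = extendLabeling χ (e'.map g) at heq
    rw [hedge] at he he'
    rcases he with rfl | rfl <;> rcases he' with rfl | rfl
    · rfl
    · rw [Sym2.map_mk, Sym2.map_mk, hgx, hgy, hgz, hgw] at heq; exact absurd heq hne
    · rw [Sym2.map_mk, Sym2.map_mk, hgx, hgy, hgz, hgw] at heq; exact absurd heq.symm hne
    · rfl

/-- If disjoint edges have the same colour, then in two disjoint copies of `H₁` all edges have the
same colour. -/
lemma IsTwoEdgeMatching.arrows [Finite V] [Finite W₂] {G : SimpleGraph V} {H₁ : SimpleGraph W₁}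
    {H₂ : SimpleGraph W₂} (hH₂ : IsTwoEdgeMatching H₂) (hV : Nat.card W₂ ≤ Nat.card V)
    (h : H₁ ⊕g H₁ ⊑ G) : Arrows G H₁ H₂ := by
  obtain ⟨f⟩ := h
  intro χ
  by_contra! hχ
  obtain ⟨hmono, hrain⟩ := hχ
  refine hmono (f.comp Embedding.sumInl.toCopy) ((isMonochromatic_iff _ _).2 ?_)
  by_cases h0 : H₁ = ⊥
  · exact ⟨0, by simp [h0]⟩
  obtain ⟨a, b, hab⟩ := ne_bot_iff_exists_adj.1 h0
  refine ⟨extendLabeling χ s(f (Sum.inr a), f (Sum.inr b)), fun e he => ?_⟩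
  induction e with
  | _ x y =>
    have hne (u v : W₁) : f (Sum.inl u) ≠ f (Sum.inr v) := fun h => by
      simpa using f.injective h
    have hxy : (H₁ ⊕g H₁).Adj (Sum.inl x) (Sum.inl y) := sum_adj_inl.2 he
    have hab' : (H₁ ⊕g H₁).Adj (Sum.inr a) (Sum.inr b) := sum_adj_inr.2 hab
    exact hH₂.color_eq hV (fun ⟨g, hg⟩ => hrain g hg) (f.toHom.map_adj hxy)
      (f.toHom.map_adj hab') (hne _ _) (hne _ _) (hne _ _) (hne _ _)

end TwoEdges

/-! ### Thresholds -/

section Powers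

/-- To be a threshold of the form `n ^ (-a)` is a statement about the limit of `n ^ a * p`. -/
lemma isThreshold_rpow {a : ℝ} (ha : 0 < a) {P : ∀ n : ℕ, SimpleGraph (Fin n) → Prop}
    (h1 : ∀ p : ℕ → I, (∀ᶠ n in atTop, 0 < (p n : ℝ)) →
      Tendsto (fun n : ℕ => (n : ℝ) ^ a * p n) atTop atTop →
      Tendsto (fun n => (binomialRandom (Fin n) (p n)).real {G | P n G}) atTop (𝓝 1))
    (h0 : ∀ p : ℕ → I, Tendsto (fun n : ℕ => (n : ℝ) ^ a * p n) atTop (𝓝 0) →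
      Tendsto (fun n => (binomialRandom (Fin n) (p n)).real {G | P n G}) atTop (𝓝 0)) :
    IsThreshold P (fun n => (n : ℝ) ^ (-a)) := by
  refine ⟨fun n => ⟨by positivity, ?_⟩, fun p => ⟨fun hp => ?_, fun hp => ?_⟩⟩
  · rcases Nat.eq_zero_or_pos n with rfl | hn
    · simp [Real.zero_rpow (neg_ne_zero.2 ha.ne')]
    · exact Real.rpow_le_one_of_one_le_of_nonpos (by exact_mod_cast hn) (by linarith)
  · have key (C : ℝ) (hC : 0 < C) : ∀ᶠ n : ℕ in atTop, C ≤ (n : ℝ) ^ a * p n := by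
      filter_upwards [(Asymptotics.isLittleO_iff.1 hp) (inv_pos.2 hC), eventually_gt_atTop 0]
        with n hn hn0
      have hn1 : (0 : ℝ) < n := by exact_mod_cast hn0
      rw [Real.norm_of_nonneg (by positivity), Real.norm_of_nonneg (p n).2.1,
        Real.rpow_neg hn1.le, inv_mul_eq_div, le_div_iff₀ hC, inv_mul_eq_div,
        div_le_iff₀ (by positivity)] at hn
      linarith
    refine h1 p ?_ (tendsto_atTop.2 fun C => ?_)
    · filter_upwards [key 1 one_pos] with n hn
      refine lt_of_le_of_ne (p n).2.1 fun h => ?_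
      rw [← h, mul_zero] at hn
      linarith
    · filter_upwards [key (max C 1) (by positivity)] with n hn
      exact (le_max_left _ _).trans hn
  · refine h0 p (hp.tendsto_div_nhds_zero.congr fun n => ?_)
    rw [Real.rpow_neg (by positivity), div_inv_eq_mul, mul_comm]

lemma tendsto_pow_mul_pow_atTop {a : ℝ} {p : ℕ → I}
    (hp : Tendsto (fun n : ℕ => (n : ℝ) ^ a * p n) atTop atTop) {v e : ℕ} (hv : 1 ≤ v)
    (hve : a * e ≤ v) :
    Tendsto (fun n : ℕ => (n : ℝ) ^ v * (p n : ℝ) ^ e) atTop atTop := by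
  rcases Nat.eq_zero_or_pos e with rfl | he
  · simp only [pow_zero, mul_one]
    exact (tendsto_pow_atTop (α := ℝ) (by omega : v ≠ 0)).comp tendsto_natCast_atTop_atTop
  · refine tendsto_atTop_mono' _ ?_ ((tendsto_pow_atTop he.ne').comp hp)
    filter_upwards [eventually_gt_atTop 0] with n hn
    have hn1 : (1 : ℝ) ≤ n := by exact_mod_cast hn
    rw [Function.comp_apply, mul_pow, ← Real.rpow_mul_natCast (by positivity)]
    refine mul_le_mul_of_nonneg_right ?_ (pow_nonneg (p n).2.1 _)
    rw [← Real.rpow_natCast]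
    exact Real.rpow_le_rpow_of_exponent_le hn1 hve

lemma tendsto_pow_mul_pow_zero {a : ℝ} {p : ℕ → I}
    (hp : Tendsto (fun n : ℕ => (n : ℝ) ^ a * p n) atTop (𝓝 0)) {v e : ℕ} (he : e ≠ 0)
    (hve : a * e = v) :
    Tendsto (fun n : ℕ => (n : ℝ) ^ v * (p n : ℝ) ^ e) atTop (𝓝 0) := by
  have := hp.pow e
  rw [zero_pow he] at this
  refine this.congr fun n => ?_
  rw [mul_pow, ← Real.rpow_mul_natCast (by positivity), hve, Real.rpow_natCast]

end Powers

section Density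

variable {W : Type*} [Finite W]

lemma finite_densities (H : SimpleGraph W) :
    {x : ℝ | ∃ J : H.Subgraph, J.verts.Nonempty ∧
      x = (J.edgeSet.ncard : ℝ) / (J.verts.ncard : ℝ)}.Finite := by
  refine (Set.finite_range fun J : H.Subgraph =>
    (J.edgeSet.ncard : ℝ) / (J.verts.ncard : ℝ)).subset ?_
  rintro _ ⟨J, -, rfl⟩
  exact ⟨J, rfl⟩

lemma exists_subgraph_eq_maxDensity [Nonempty W] (H : SimpleGraph W) :
    ∃ J : H.Subgraph, J.verts.Nonempty ∧
      maxDensity H = (J.edgeSet.ncard : ℝ) / (J.verts.ncard : ℝ) :=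
  Set.Nonempty.csSup_mem (s := {x : ℝ | ∃ J : H.Subgraph, J.verts.Nonempty ∧
    x = (J.edgeSet.ncard : ℝ) / (J.verts.ncard : ℝ)}) ⟨_, ⊤, by simp, rfl⟩ (finite_densities H)

lemma ncard_edgesIn_le (H : SimpleGraph W) {S : Set W} (hS : S.Nonempty) :
    ((edgesIn H S).ncard : ℝ) ≤ maxDensity H * S.ncard := by
  have hS' : 0 < S.ncard := (Set.ncard_pos (Set.toFinite _)).2 hS
  rw [← div_le_iff₀ (by exact_mod_cast hS')]
  refine le_csSup (finite_densities H).bddAbove ⟨(⊤ : H.Subgraph).induce S, hS, ?_⟩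
  congr 3
  ext e
  induction e with
  | _ a b => simp [edgesIn]; tauto

lemma maxDensity_pos {H : SimpleGraph W} (hH : 0 < H.edgeSet.ncard) : 0 < maxDensity H := by
  obtain ⟨e, he⟩ := (Set.ncard_pos (Set.toFinite _)).1 hH
  have : Nonempty W := ⟨e.out.1⟩
  have h := ncard_edgesIn_le H (Set.univ_nonempty (α := W))
  have h2 : edgesIn H Set.univ = H.edgeSet := by simp [edgesIn]
  rw [h2] at h
  have h3 : (0 : ℝ) < H.edgeSet.ncard := by exact_mod_cast hH
  exact pos_of_mul_pos_left (h3.trans_le h) (Nat.cast_nonneg _)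

lemma ncard_edgeSet_cycleGraph {k : ℕ} (hk : 3 ≤ k) : (cycleGraph k).edgeSet.ncard = k := by
  classical
  obtain ⟨k, rfl⟩ : ∃ m, k = m + 3 := ⟨k - 3, by omega⟩
  have h := sum_degrees_eq_twice_card_edges (cycleGraph (k + 3))
  simp only [cycleGraph_degree_three_le, Finset.sum_const, Finset.card_univ, Fintype.card_fin,
    smul_eq_mul] at h
  rw [← coe_edgeFinset, Set.ncard_coe_finset]
  omega

lemma one_le_maxDensity {H : SimpleGraph W} (hH : ¬ H.IsAcyclic) : 1 ≤ maxDensity H := by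
  rw [isAcyclic_iff_free_cycleGraph] at hH
  push Not at hH
  obtain ⟨k, hk, ⟨f⟩⟩ := hH
  have hne : Nonempty (Fin k) := ⟨⟨0, by omega⟩⟩
  have hcard : (Set.range f).ncard = k := by
    rw [← Set.image_univ, Set.ncard_image_of_injective (f := f) _ f.injective, Set.ncard_univ]
    simp
  have h1 : (k : ℝ) ≤ (edgesIn H (Set.range f)).ncard := by
    have : k ≤ (edgesIn H (Set.range f)).ncard := by
      refine (ncard_edgeSet_cycleGraph hk).symm.le.trans ?_
      rw [← Set.ncard_image_of_injective _ (Sym2.map.injective (f := f) f.injective)]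
      refine Set.ncard_le_ncard ?_ (Set.toFinite _)
      rintro _ ⟨e, he, rfl⟩
      refine ⟨(f.mapEdgeSet ⟨e, he⟩).2, fun x hx => ?_⟩
      obtain ⟨y, -, rfl⟩ := Sym2.mem_map.1 hx
      exact ⟨y, rfl⟩
    exact_mod_cast this
  have h2 := ncard_edgesIn_le H (Set.range_nonempty f)
  rw [hcard] at h2
  have hk0 : (0 : ℝ) < k := by exact_mod_cast (by omega : 0 < k)
  exact le_of_mul_le_mul_right (by linarith) hk0

lemma ncard_edgesIn_sum_le {W' : Type*} [Finite W'] (H : SimpleGraph W) (H' : SimpleGraph W')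
    (S : Set (W ⊕ W')) :
    (edgesIn (H ⊕g H') S).ncard ≤
      (edgesIn H (Sum.inl ⁻¹' S)).ncard + (edgesIn H' (Sum.inr ⁻¹' S)).ncard := by
  have hsub : edgesIn (H ⊕g H') S ⊆ Sym2.map Sum.inl '' edgesIn H (Sum.inl ⁻¹' S) ∪
      Sym2.map Sum.inr '' edgesIn H' (Sum.inr ⁻¹' S) := by
    rintro e ⟨he, heS⟩
    induction e with
    | _ a b =>
      have ha := heS a (Sym2.mem_mk_left _ _)
      have hb := heS b (Sym2.mem_mk_right _ _)
      rcases a with a | a <;> rcases b with b | b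
      · left
        exact ⟨s(a, b), ⟨(sum_adj_inl (H := H')).1 he, by simp [ha, hb]⟩, rfl⟩
      · simp [SimpleGraph.sum] at he
      · simp [SimpleGraph.sum] at he
      · right
        exact ⟨s(a, b), ⟨(sum_adj_inr (G := H)).1 he, by simp [ha, hb]⟩, rfl⟩
  refine (Set.ncard_le_ncard hsub (Set.toFinite _)).trans ((Set.ncard_union_le _ _).trans ?_)
  exact add_le_add (Set.ncard_image_le (Set.toFinite _)) (Set.ncard_image_le (Set.toFinite _))

/-- Two disjoint copies of a graph are not denser than the graph. -/
lemma ncard_edgesIn_sum_self_le (H : SimpleGraph W) (S : Set (W ⊕ W)) :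
    ((edgesIn (H ⊕g H) S).ncard : ℝ) ≤ maxDensity H * S.ncard := by
  have key (T : Set W) : ((edgesIn H T).ncard : ℝ) ≤ maxDensity H * T.ncard := by
    rcases T.eq_empty_or_nonempty with rfl | hT
    · simp [edgesIn_empty]
    · exact ncard_edgesIn_le H hT
  have h1 : ((edgesIn (H ⊕g H) S).ncard : ℝ) ≤
      (edgesIn H (Sum.inl ⁻¹' S)).ncard + (edgesIn H (Sum.inr ⁻¹' S)).ncard := by
    exact_mod_cast ncard_edgesIn_sum_le H H S
  have h2 : S.ncard = (Sum.inl ⁻¹' S : Set W).ncard + (Sum.inr ⁻¹' S : Set W).ncard := by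
    rw [← Set.ncard_image_of_injective (Sum.inl ⁻¹' S) (Sum.inl_injective (β := W)),
      ← Set.ncard_image_of_injective (Sum.inr ⁻¹' S) (Sum.inr_injective (α := W)),
      ← Set.ncard_union_eq _ (Set.toFinite _) (Set.toFinite _), Set.image_preimage_inl_union_image_preimage_inr]
    rw [Set.disjoint_left]
    rintro _ ⟨a, -, rfl⟩ ⟨b, -, h⟩
    simp at h
  rw [h2]
  push_cast
  linarith [key (Sum.inl ⁻¹' S), key (Sum.inr ⁻¹' S)]

lemma ncard_edgesIn_add_one_le {H : SimpleGraph W} (hH : H.IsAcyclic) {S : Set W}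
    (hS : S.Nonempty) : (edgesIn H S).ncard + 1 ≤ S.ncard := by
  classical
  have : Nonempty S := hS.to_subtype
  have := Fintype.ofFinite S
  obtain ⟨T, hT, -, hTtree⟩ := (connected_top (V := S)).exists_isTree_le_of_le_of_isAcyclic
    (le_top : H.induce S ≤ ⊤) (hH.induce S)
  have h1 : T.edgeSet.ncard + 1 = S.ncard := by
    rw [← coe_edgeFinset, Set.ncard_coe_finset, hTtree.card_edgeFinset,
      ← Nat.card_eq_fintype_card, Nat.card_coe_set_eq]
  rw [← h1]
  refine Nat.add_le_add_right ?_ 1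
  rw [← Set.ncard_image_of_injective T.edgeSet (Sym2.map.injective Subtype.val_injective)]
  refine Set.ncard_le_ncard ?_ (Set.toFinite _)
  rintro e ⟨he, heS⟩
  induction e with
  | _ a b =>
    exact ⟨s(⟨a, heS a (Sym2.mem_mk_left _ _)⟩, ⟨b, heS b (Sym2.mem_mk_right _ _)⟩),
      hT he, rfl⟩

end Density

section Thresholds

variable {W₁ W₂ : Type*} [Finite W₁] [Finite W₂]

lemma tendsto_one_of_eventually_subset {p : ℕ → I} {A B : ∀ n, Set (SimpleGraph (Fin n))}
    (hA : Tendsto (fun n => (binomialRandom (Fin n) (p n)).real (A n)) atTop (𝓝 1))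
    (hAB : ∀ᶠ n in atTop, A n ⊆ B n) :
    Tendsto (fun n => (binomialRandom (Fin n) (p n)).real (B n)) atTop (𝓝 1) :=
  tendsto_of_tendsto_of_tendsto_of_le_of_le' hA tendsto_const_nhds
    (hAB.mono fun _ h => measureReal_mono h) (.of_forall fun _ => measureReal_le_one)

lemma tendsto_measureReal_not_isAcyclic {p : ℕ → I}
    (hp : Tendsto (fun n : ℕ => (n : ℝ) * p n) atTop (𝓝 0)) :
    Tendsto (fun n => (binomialRandom (Fin n) (p n)).real {G | ¬ G.IsAcyclic}) atTop (𝓝 0) := by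
  have h4 : Tendsto (fun n : ℕ => 4 * ((n : ℝ) * p n)) atTop (𝓝 0) := by
    simpa using hp.const_mul 4
  refine squeeze_zero' (.of_forall fun _ => measureReal_nonneg) ?_ h4
  filter_upwards [hp.eventually_le_const (show (0 : ℝ) < 1 / 2 by norm_num)] with n hn
  set x : ℝ := (n : ℝ) * p n with hx
  have hx0 : 0 ≤ x := mul_nonneg (Nat.cast_nonneg _) (p n).2.1
  have hsub : {G : SimpleGraph (Fin n) | ¬ G.IsAcyclic} ⊆
      ⋃ k ∈ Finset.Icc 3 n, {G | cycleGraph k ⊑ G} := by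
    intro G hG
    rw [Set.mem_ofPred_eq, isAcyclic_iff_free_cycleGraph] at hG
    push Not at hG
    obtain ⟨k, hk, hkG⟩ := hG
    have hkn : k ≤ n := by
      obtain ⟨f⟩ := hkG
      simpa using Fintype.card_le_of_injective f f.injective
    exact Set.mem_biUnion (Finset.mem_coe.2 (Finset.mem_Icc.2 ⟨hk, hkn⟩)) hkG
  calc (binomialRandom (Fin n) (p n)).real {G | ¬ G.IsAcyclic}
      ≤ ∑ k ∈ Finset.Icc 3 n, (binomialRandom (Fin n) (p n)).real {G | cycleGraph k ⊑ G} :=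
        (measureReal_mono hsub (measure_ne_top _ _)).trans (measureReal_biUnion_finset_le _ _)
    _ ≤ ∑ k ∈ Finset.Icc 3 n, 2 * x * (1 / 2) ^ k := by
        refine Finset.sum_le_sum fun k hk => ?_
        have hk3 := (Finset.mem_Icc.1 hk).1
        refine (measureReal_isContained_le (p n) (cycleGraph k)).trans ?_
        rw [ncard_edgeSet_cycleGraph hk3, Nat.card_fin, Nat.card_fin, ← mul_pow, ← hx]
        obtain ⟨j, rfl⟩ : ∃ j, k = j + 1 := ⟨k - 1, by omega⟩
        rw [pow_succ, pow_succ]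
        have := pow_le_pow_left₀ hx0 hn j
        nlinarith
    _ ≤ ∑ k ∈ Finset.range (n + 1), 2 * x * (1 / 2) ^ k := by
        refine Finset.sum_le_sum_of_subset_of_nonneg (fun k hk => ?_) fun _ _ _ => by positivity
        rw [Finset.mem_Icc] at hk
        exact Finset.mem_range.2 (by omega)
    _ ≤ 4 * x := by
        rw [← Finset.mul_sum]
        nlinarith [sum_geometric_two_le (n + 1)]

theorem isRamseyThreshold_of_isMatching (H₁ : SimpleGraph W₁) (H₂ : SimpleGraph W₂)
    (hH₂ : H₂.IsAcyclic) (he₁ : 2 ≤ H₁.edgeSet.ncard) (hH₁ : IsMatching H₁)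
    (hsf : ¬ IsShortForest H₂) :
    IsRamseyThreshold H₁ H₂ (fun n => (n : ℝ) ^ (-1 : ℝ)) := by
  have hne : Nonempty W₂ := by
    rcases exists_of_not_isShortForest hsf with ⟨a, -⟩ | ⟨a, -⟩ <;> exact ⟨a⟩
  refine isThreshold_rpow one_pos (fun p hp0 hp => ?_) (fun p hp => ?_)
  · simp only [Real.rpow_one] at hp
    obtain ⟨N, hN⟩ := exists_arrows_of_not_colorable H₁ H₂ hH₁ hH₂
    have h1 := (tendsto_measureReal_colorable p hp N).const_sub 1
    rw [sub_zero] at h1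
    refine tendsto_one_of_eventually_subset (A := fun n => {G | ¬ G.Colorable N})
      (h1.congr fun n => ?_) ?_
    · rw [← probReal_compl_eq_one_sub (Set.toFinite _).measurableSet]
      rfl
    · filter_upwards [eventually_ge_atTop (Nat.card W₁)] with n hn G hG
      exact hN G (by simpa using hn) hG
  · simp only [Real.rpow_one] at hp
    refine squeeze_zero (fun _ => measureReal_nonneg) (fun n => measureReal_mono ?_)
      (tendsto_measureReal_not_isAcyclic hp)
    intro G hG hac
    exact not_arrows_of_isAcyclic hac hH₁ he₁ (exists_of_not_isShortForest hsf) hG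

/-- Below `n ^ (-1 / m(H))` there is no copy of a densest subgraph of `H`. -/
lemma tendsto_measureReal_isContained_zero {H : SimpleGraph W₁} (hH : 0 < H.edgeSet.ncard)
    {p : ℕ → I}
    (hp : Tendsto (fun n : ℕ => (n : ℝ) ^ (1 / maxDensity H) * p n) atTop (𝓝 0)) :
    Tendsto (fun n => (binomialRandom (Fin n) (p n)).real {G | H ⊑ G}) atTop (𝓝 0) := by
  obtain ⟨e, he⟩ := (Set.ncard_pos (Set.toFinite _)).1 hH
  have : Nonempty W₁ := ⟨e.out.1⟩
  obtain ⟨J, hJ, hm⟩ := exists_subgraph_eq_maxDensity H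
  have hm0 := maxDensity_pos hH
  have hv : (0 : ℝ) < J.verts.ncard := by exact_mod_cast (Set.ncard_pos (Set.toFinite _)).2 hJ
  have heJ : J.edgeSet.ncard ≠ 0 := by
    intro h
    rw [hm, h] at hm0
    simp at hm0
  have hedge : J.coe.edgeSet.ncard = J.edgeSet.ncard := by
    rw [← Subgraph.image_coe_edgeSet_coe,
      Set.ncard_image_of_injective _ (Sym2.map.injective Subtype.val_injective)]
  refine squeeze_zero (fun _ => measureReal_nonneg) (fun n => ?_)
    (tendsto_pow_mul_pow_zero hp (v := J.verts.ncard) heJ ?_)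
  · refine (measureReal_mono (show {G : SimpleGraph (Fin n) | H ⊑ G} ⊆ {G | J.coe ⊑ G} from
      fun G hG => J.coe_isContained.trans hG)).trans ?_
    refine (measureReal_isContained_le (p n) J.coe).trans_eq ?_
    rw [hedge, Nat.card_fin, Nat.card_coe_set_eq]
  · rw [hm]
    have : (J.edgeSet.ncard : ℝ) ≠ 0 := by exact_mod_cast heJ
    field_simp

theorem isRamseyThreshold_maxDensity (H₁ : SimpleGraph W₁) (H₂ : SimpleGraph W₂)
    (he₁ : 2 ≤ H₁.edgeSet.ncard) (he₂ : 2 ≤ H₂.edgeSet.ncard)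
    (h : (¬ H₁.IsAcyclic ∧ IsCherry H₂) ∨ IsTwoEdgeMatching H₂) :
    IsRamseyThreshold H₁ H₂ (fun n => (n : ℝ) ^ (-1 / maxDensity H₁)) := by
  have hm0 : 0 < maxDensity H₁ := maxDensity_pos (by omega)
  simp only [neg_div]
  refine isThreshold_rpow (by positivity) (fun p hp0 hp => ?_) (fun p hp => ?_)
  · rcases h with ⟨hcyc, hch⟩ | hmat
    · have hm1 := one_le_maxDensity hcyc
      have hnp : Tendsto (fun n : ℕ => (n : ℝ) * p n) atTop atTop := by
        refine tendsto_atTop_mono' _ ?_ hp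
        filter_upwards [eventually_gt_atTop 0] with n hn
        have hn1 : (1 : ℝ) ≤ n := by exact_mod_cast hn
        refine mul_le_mul_of_nonneg_right ?_ (p n).2.1
        calc (n : ℝ) ^ (1 / maxDensity H₁) ≤ (n : ℝ) ^ (1 : ℝ) :=
              Real.rpow_le_rpow_of_exponent_le hn1 (by rw [div_le_one hm0]; exact hm1)
          _ = n := Real.rpow_one _
      refine tendsto_one_of_eventually_subset
        (tendsto_measureReal_exists_copy_reachable p H₁ hp0 hnp fun J hJ => ?_) ?_
      · refine tendsto_pow_mul_pow_atTop hp ((Set.ncard_pos (Set.toFinite _)).2 hJ) ?_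
        rw [div_mul_eq_mul_div, one_mul, div_le_iff₀ hm0, mul_comm]
        exact ncard_edgesIn_le H₁ hJ
      · filter_upwards [eventually_ge_atTop (Nat.card W₂)] with n hn
        rintro G ⟨f, hf⟩
        exact hch.arrows (by simpa using hn) f fun a _ b _ => hf a b
    · have hcopy := tendsto_measureReal_exists_copy p (H₁ ⊕g H₁) hp0 (fun J hJ => ?_)
        (fun _ _ => ∅) (fun _ _ _ _ _ => Iff.rfl) (fun δ hδ => .of_forall fun n f => by simp [hδ.le])
      · refine tendsto_one_of_eventually_subset hcopy ?_
        filter_upwards [eventually_ge_atTop (Nat.card W₂)] with n hn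
        rintro G ⟨f, hf, -⟩
        exact hmat.arrows (by simpa using hn) ⟨copyOfInjective f f.injective hf⟩
      · refine tendsto_pow_mul_pow_atTop hp ((Set.ncard_pos (Set.toFinite _)).2 hJ) ?_
        rw [div_mul_eq_mul_div, one_mul, div_le_iff₀ hm0, mul_comm]
        exact ncard_edgesIn_sum_self_le H₁ J
  · refine squeeze_zero (fun _ => measureReal_nonneg) (fun n => measureReal_mono ?_)
      (tendsto_measureReal_isContained_zero (by omega) hp)
    exact fun G hG => isContained_of_arrows he₂ hG

theorem isRamseyThreshold_of_isAcyclic (H₁ : SimpleGraph W₁) (H₂ : SimpleGraph W₂)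
    (he₁ : 2 ≤ H₁.edgeSet.ncard) (k : ℕ) (hH₁ : H₁.IsAcyclic) (hk : H₁.support.ncard = k)
    (hH₂ : IsCherry H₂) :
    IsRamseyThreshold H₁ H₂ (fun n => (n : ℝ) ^ (-(k : ℝ) / ((k : ℝ) - 1))) := by
  classical
  have hk2 : 2 ≤ k := by
    obtain ⟨e, he⟩ := (Set.ncard_pos (Set.toFinite _)).1 (show 0 < H₁.edgeSet.ncard by omega)
    induction e with
    | _ a b =>
      have hab : H₁.Adj a b := he
      rw [← hk, ← Set.ncard_pair hab.ne]
      refine Set.ncard_le_ncard ?_ (Set.toFinite _)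
      rintro x (rfl | rfl)
      · exact ⟨b, hab⟩
      · exact ⟨a, hab.symm⟩
  have hk1 : (0 : ℝ) < (k : ℝ) - 1 := by
    have : (2 : ℝ) ≤ k := by exact_mod_cast hk2
    linarith
  have hk0 : (0 : ℝ) < k := by linarith
  simp only [neg_div]
  refine isThreshold_rpow (by positivity) (fun p hp0 hp => ?_) (fun p hp => ?_)
  · -- extend `H₁` to a tree on its support
    have hsne : Nonempty H₁.support :=
      ((Set.ncard_pos (Set.toFinite _)).1 (show 0 < H₁.support.ncard by omega)).to_subtype
    obtain ⟨T, hT, -, hTtree⟩ :=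
      (connected_top (V := H₁.support)).exists_isTree_le_of_le_of_isAcyclic
        (le_top : H₁.induce H₁.support ≤ ⊤) (hH₁.induce _)
    have hcopy := tendsto_measureReal_exists_copy p T hp0 (fun J hJ => ?_)
      (fun _ _ => ∅) (fun _ _ _ _ _ => Iff.rfl) (fun δ hδ => .of_forall fun n f => by simp [hδ.le])
    · refine tendsto_one_of_eventually_subset hcopy ?_
      filter_upwards [eventually_ge_atTop (max (Nat.card W₁) (Nat.card W₂))] with n hn
      rintro G ⟨f, hf, -⟩
      obtain ⟨a₀⟩ := hsne
      obtain ⟨g, hg⟩ := exists_embedding_eqOn (V := Fin n) (by simpa using (le_max_left _ _).trans hn)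
        H₁.support (fun w => if hw : w ∈ H₁.support then f ⟨w, hw⟩ else f a₀) (by
          intro a ha b hb hab
          simp only [ha, hb, dif_pos] at hab
          exact congrArg Subtype.val (f.injective hab))
      have hgf (a : W₁) (ha : a ∈ H₁.support) : g a = f ⟨a, ha⟩ := (hg ha).trans (dif_pos ha)
      refine hH₂.arrows (by simpa using (le_max_right _ _).trans hn)
        (copyOfInjective g g.injective fun a b hab => ?_) fun a ha b hb => ?_
      · rw [hgf a ⟨b, hab⟩, hgf b ⟨a, hab.symm⟩]
        exact hf _ _ (hT hab)
      · rw [copyOfInjective_apply, copyOfInjective_apply, hgf a ha, hgf b hb]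
        exact (hTtree.connected.preconnected ⟨a, ha⟩ ⟨b, hb⟩).map (⟨f, fun {a b} => hf a b⟩ : T →g G)
    · refine tendsto_pow_mul_pow_atTop hp ((Set.ncard_pos (Set.toFinite _)).2 hJ) ?_
      have h1 := ncard_edgesIn_add_one_le hTtree.isAcyclic hJ
      have h2 : J.ncard ≤ k := by
        have := Set.ncard_le_card J
        rwa [Nat.card_coe_set_eq, hk] at this
      have h1' : ((edgesIn T J).ncard : ℝ) + 1 ≤ J.ncard := by exact_mod_cast h1
      have h2' : (J.ncard : ℝ) ≤ k := by exact_mod_cast h2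
      rw [div_mul_eq_mul_div, div_le_iff₀ hk1]
      nlinarith
  · have hsum : Tendsto (fun n : ℕ => ∑ T : {T : SimpleGraph (Fin k) // T.IsTree},
        (n : ℝ) ^ k * (p n : ℝ) ^ (k - 1)) atTop (𝓝 0) := by
      rw [show (0 : ℝ) = ∑ T : {T : SimpleGraph (Fin k) // T.IsTree}, 0 by simp]
      refine tendsto_finsetSum _ fun T _ => tendsto_pow_mul_pow_zero hp (by omega) ?_
      rw [Nat.cast_sub (by omega)]
      push_cast
      field_simp
    refine squeeze_zero (fun _ => measureReal_nonneg) (fun n => ?_) hsum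
    have hsub : {G : SimpleGraph (Fin n) | Arrows G H₁ H₂} ⊆
        ⋃ T : {T : SimpleGraph (Fin k) // T.IsTree}, {G | T.1 ⊑ G} := by
      intro G hG
      obtain ⟨T, hT, hTG⟩ := hH₂.exists_isTree_of_arrows (by omega) hk hG
      exact Set.mem_iUnion.2 ⟨⟨T, hT⟩, hTG⟩
    refine ((measureReal_mono hsub).trans (measureReal_iUnion_fintype_le _)).trans ?_
    refine Finset.sum_le_sum fun T _ => (measureReal_isContained_le (p n) T.1).trans_eq ?_
    have : T.1.edgeSet.ncard = k - 1 := by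
      have := T.2.card_edgeFinset
      rw [Fintype.card_fin] at this
      rw [← coe_edgeFinset, Set.ncard_coe_finset]
      omega
    rw [this, Nat.card_fin, Nat.card_fin]

end Thresholds

end ConstrainedRamsey

theorem proposition2 {W₁ W₂ : Type*} [Finite W₁] [Finite W₂]
    (H₁ : SimpleGraph W₁) (H₂ : SimpleGraph W₂)
    (hH₂ : H₂.IsAcyclic)
    (he₁ : 2 ≤ H₁.edgeSet.ncard) (he₂ : 2 ≤ H₂.edgeSet.ncard) :
    (ConstrainedRamsey.IsMatching H₁ → ¬ ConstrainedRamsey.IsShortForest H₂ →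
      ConstrainedRamsey.IsRamseyThreshold H₁ H₂ (fun n => (n : ℝ) ^ (-1 : ℝ))) ∧
    ((¬ H₁.IsAcyclic ∧ ConstrainedRamsey.IsCherry H₂) ∨ ConstrainedRamsey.IsTwoEdgeMatching H₂ →
      ConstrainedRamsey.IsRamseyThreshold H₁ H₂
        (fun n => (n : ℝ) ^ (-1 / ConstrainedRamsey.maxDensity H₁))) ∧
    (∀ k : ℕ, H₁.IsAcyclic → H₁.support.ncard = k → ConstrainedRamsey.IsCherry H₂ →
      ConstrainedRamsey.IsRamseyThreshold H₁ H₂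
        (fun n => (n : ℝ) ^ (-(k : ℝ) / ((k : ℝ) - 1)))) := by
  refine ⟨fun hmat hsf => ?_, fun h => ?_, fun k hac hk hch => ?_⟩
  · exact ConstrainedRamsey.isRamseyThreshold_of_isMatching H₁ H₂ hH₂ he₁ hmat hsf
  · exact ConstrainedRamsey.isRamseyThreshold_maxDensity H₁ H₂ he₁ he₂ h
  · exact ConstrainedRamsey.isRamseyThreshold_of_isAcyclic H₁ H₂ he₁ k hac hk hch
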